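/- Let $n\neq 2$ be a nonnegative integer, $a>1$ and $A\in\mathbb R$. Write $\|x\|=\sum_i|x_i|$ for $x\in\mathbb R^n$, and for probability measures $\mu,\nu$ on $\mathbb R^n$ let $$d(\mu,\nu)=\inf_{\Pi}\int\|\xi-\xi'\|\,d\Pi(\xi,\xi')$$ be the Wasserstein distance of order $1$, the infimum being over all couplings $\Pi$ of $\mu$ and $\nu$. Then there are constants $c_1,c_2>0$, depending only on $a$, $n$ and $A$, such that the following holds. Let $\mathfrak X=\{x\in\mathbb R^n: x_{\min}\le x\le x_{\max}\}$ be a box, let $\mathbb F$ be a probability measure on $\mathbb R^n$ with $\mathbb F(\mathfrak X)=1$, let $\mathfrak X^\star\supseteq\mathfrak X$ be a compact convex subset of $\mathbb R^n$, and let $\mathbb O(\cdot\mid x)$ be a Markov kernel on $\mathbb R^n$ with $\mathbb O(\mathfrak X^\star\mid x)=1$ for all $x\in\mathfrak X$ (for example additive noise, $\mathbb O(A\mid x)=\mathbb F_E(A-x)$). Let $\mathbb F^\star(\cdot)=\int\mathbb O(\cdot\mid x)\,d\mathbb F(x)$ be the distribution of the noisy data, and suppose that $\int \exp(\|x\|^a)\,d\mathbb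 F^\star(x)=A$. Let $N\ge1$, let $\widehat X_1^\star,\dots,\widehat X_N^\star$ be independent samples from $\mathbb F^\star$, with joint law $\mathbb P^{\star N}$, and let $\widehat{\mathbb F}^\star=\frac1N\sum_{j=1}^N\delta_{\widehat X_j^\star}$. For $\varepsilon>0$ put $$b_N(\varepsilon)=\begin{cases}c_1\exp(-c_2N\varepsilon^{\max\{n,2\}}),&\varepsilon\le1,\\ c_1\exp(-c_2N\varepsilon^{a}),&\varepsilon>1.\end{cases}$$ (i) For every $\varepsilon>0$, $\ \mathbb P^{\star N}\{d(\mathbb F^\star,\widehat{\mathbb F}^\star)\ge\varepsilon\}\le b_N(\varepsilon)$. (ii) For every $\beta\in(0,1)$, let $$\varepsilon_N(\beta)=\begin{cases}\left(\dfrac{\log(c_1\beta^{-1})}{c_2N}\right)^{1/\max\{n,2\}},&N\ge\dfrac{\log(c_1\beta^{-1})}{c_2},\\[2ex]\left(\dfrac{\log(c_1\beta^{-1})}{c_2N}\right)^{1/a},&N<\dfrac{\log(c_1\beta^{-1})}{c_2}.\end{cases}$$ Then $b_N(\varepsilon_N(\beta))=\beta$, and $\varepsilon_N(\beta)$ is the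 smallest $\varepsilon>0$ for which the bound in (i) guarantees confidence at least $1-\beta$, i.e. for which $1-b_N(\varepsilon)\ge1-\beta$. Moreover $\mathbb F^\star$ lies in the closed Wasserstein ball (among the probability measures supported on $\mathfrak X^\star$) of radius $\varepsilon_N(\beta)$ around $\widehat{\mathbb F}^\star$ with $\mathbb P^{\star N}$-probability at least $1-\beta$. -/

import Mathlib

open MeasureTheory ProbabilityTheory
open scoped ENNReal

namespace NoisyDRO

noncomputable section

/-- The `ℓ₁`-norm on `ℝⁿ` (the built-in norm of `Fin n → ℝ` is the sup norm, so it is not used). -/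
def l1norm {n : ℕ} (x : Fin n → ℝ) : ℝ := ∑ i, |x i|

/-- The couplings of `μ` and `ν`: joint distributions with marginals `μ` and `ν`. -/
def couplings {n : ℕ} (μ ν : Measure (Fin n → ℝ)) :
    Set (Measure ((Fin n → ℝ) × (Fin n → ℝ))) :=
  {π | π.map Prod.fst = μ ∧ π.map Prod.snd = ν}

/-- The Wasserstein distance of order `1` with respect to the `ℓ₁`-norm, with values in
`[0, ∞]`. -/
def W1 {n : ℕ} (μ ν : Measure (Fin n → ℝ)) : ℝ≥0∞ :=
  ⨅ π ∈ couplings μ ν, ∫⁻ z, ENNReal.ofReal (l1norm (z.1 - z.2)) ∂π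

/-- The noise operator: the distribution `A ↦ ∫ O(A ∣ x) dF(x)` of the noisy vector, when the
latent vector has distribution `F` and its noisy observation is drawn from `O(· ∣ x)`. -/
def noisyDistribution {n : ℕ} (O : Kernel (Fin n → ℝ) (Fin n → ℝ))
    (F : Measure (Fin n → ℝ)) : Measure (Fin n → ℝ) :=
  F.bind O

/-- The empirical distribution `(1/N) ∑ⱼ δ_{xⱼ}` of `N` points. -/
def empirical {n N : ℕ} (x : Fin N → (Fin n → ℝ)) : Measure (Fin n → ℝ) :=
  (N : ℝ≥0∞)⁻¹ • ∑ j, Measure.dirac (x j)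

/-- The law of `N` independent samples drawn from `μ`. -/
def sampleLaw {n : ℕ} (N : ℕ) (μ : Measure (Fin n → ℝ)) [SigmaFinite μ] :
    Measure (Fin N → (Fin n → ℝ)) :=
  Measure.pi fun _ => μ

/-- The Wasserstein ball of radius `ε` around `ν`, within the probability measures supported
on `S`. -/
def wassersteinBall {n : ℕ} (S : Set (Fin n → ℝ)) (ε : ℝ) (ν : Measure (Fin n → ℝ)) :
    Set (Measure (Fin n → ℝ)) :=
  {μ | IsProbabilityMeasure μ ∧ μ Sᶜ = 0 ∧ W1 μ ν ≤ ENNReal.ofReal ε}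

/-- The exponential moment `E[exp(‖X‖^a)]` of `X ∼ μ`. -/
def expMoment {n : ℕ} (a : ℝ) (μ : Measure (Fin n → ℝ)) : ℝ :=
  ∫ x, Real.exp (l1norm x ^ a) ∂μ

/-- The concentration bound, as a function of the radius `ε`. -/
def concentrationBound (n N : ℕ) (a c₁ c₂ ε : ℝ) : ℝ :=
  if ε ≤ 1 then c₁ * Real.exp (-c₂ * N * ε ^ max n 2)
  else c₁ * Real.exp (-c₂ * N * ε ^ a)

/-- The radius `ε_N(β)` in closed form. -/
def radius (n N : ℕ) (a c₁ c₂ β : ℝ) : ℝ :=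
  if Real.log (c₁ * β⁻¹) / c₂ ≤ N then
    (Real.log (c₁ * β⁻¹) / (c₂ * N)) ^ (1 / ((max n 2 : ℕ) : ℝ))
  else (Real.log (c₁ * β⁻¹) / (c₂ * N)) ^ (1 / a)

instance {n : ℕ} (O : Kernel (Fin n → ℝ) (Fin n → ℝ)) [IsMarkovKernel O]
    (F : Measure (Fin n → ℝ)) [IsProbabilityMeasure F] :
    IsProbabilityMeasure (noisyDistribution O F) := by
  unfold noisyDistribution
  infer_instance

end

end NoisyDRO

namespace NoisyDRO

section l1norm
variable {n : ℕ}

lemma l1norm_nonneg (x : Fin n → ℝ) : 0 ≤ l1norm x :=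
  Finset.sum_nonneg fun _ _ => abs_nonneg _

lemma l1norm_add_le (x y : Fin n → ℝ) : l1norm (x + y) ≤ l1norm x + l1norm y := by
  unfold l1norm
  rw [← Finset.sum_add_distrib]
  exact Finset.sum_le_sum fun i _ => abs_add_le _ _

lemma l1norm_neg (x : Fin n → ℝ) : l1norm (-x) = l1norm x := by
  simp [l1norm]

lemma l1norm_zero : l1norm (0 : Fin n → ℝ) = 0 := by
  simp [l1norm]

lemma l1norm_sub_comm (x y : Fin n → ℝ) : l1norm (x - y) = l1norm (y - x) := by
  rw [← l1norm_neg, neg_sub]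

lemma l1norm_sub_le (x y : Fin n → ℝ) : l1norm (x - y) ≤ l1norm x + l1norm y := by
  have := l1norm_add_le x (-y)
  rwa [l1norm_neg, ← sub_eq_add_neg] at this

lemma l1norm_sub_le_sub_add_sub (x y z : Fin n → ℝ) :
    l1norm (x - z) ≤ l1norm (x - y) + l1norm (y - z) := by
  have := l1norm_add_le (x - y) (y - z)
  rwa [sub_add_sub_cancel] at this

lemma continuous_l1norm : Continuous (l1norm : (Fin n → ℝ) → ℝ) := by
  unfold l1norm
  fun_prop

lemma measurable_l1norm : Measurable (l1norm : (Fin n → ℝ) → ℝ) :=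
  continuous_l1norm.measurable

end l1norm

section FiniteTransport

variable {I J T : Type*} [Fintype I] [Fintype J] [DecidableEq T]

/-- Proportional matching of two finite mass distributions inside the fibres of a labelling: the
part left over on either side is, in each fibre, the positive part of the difference of masses. -/
lemma exists_partial_matching (p : I → ℝ) (q : J → ℝ) (hp : ∀ i, 0 ≤ p i) (hq : ∀ j, 0 ≤ q j)
    (f : I → T) (g : J → T) :
    ∃ π : I → J → ℝ, (∀ i j, 0 ≤ π i j) ∧ (∀ i j, f i ≠ g j → π i j = 0) ∧
      (∀ i, ∑ j, π i j ≤ p i) ∧ (∀ j, ∑ i, π i j ≤ q j) ∧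
      (∀ t, ∑ i with f i = t, (p i - ∑ j, π i j) =
        max (∑ i with f i = t, p i - ∑ j with g j = t, q j) 0) ∧
      (∀ t, ∑ j with g j = t, (q j - ∑ i, π i j) =
        max (∑ j with g j = t, q j - ∑ i with f i = t, p i) 0) := by
  set P : T → ℝ := fun t => ∑ i with f i = t, p i with hP
  set Q : T → ℝ := fun t => ∑ j with g j = t, q j with hQ
  have hP0 : ∀ t, 0 ≤ P t := fun t => Finset.sum_nonneg fun i _ => hp i
  have hQ0 : ∀ t, 0 ≤ Q t := fun t => Finset.sum_nonneg fun i _ => hq i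
  have hpP : ∀ i, p i ≤ P (f i) := fun i =>
    Finset.single_le_sum (f := p) (fun i _ => hp i) (by simp)
  have hqQ : ∀ j, q j ≤ Q (g j) := fun j =>
    Finset.single_le_sum (f := q) (fun i _ => hq i) (by simp)
  have hrow : ∀ i, ∑ j, (if f i = g j then p i * q j / max (P (f i)) (Q (f i)) else 0) =
      p i * (Q (f i) / max (P (f i)) (Q (f i))) := by
    intro i
    rw [← Finset.sum_filter]
    simp_rw [mul_div_assoc]
    rw [← Finset.mul_sum, ← Finset.sum_div]
    simp only [hQ, eq_comm]
  have hcol : ∀ j, ∑ i, (if f i = g j then p i * q j / max (P (f i)) (Q (f i)) else 0) =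
      q j * (P (g j) / max (P (g j)) (Q (g j))) := by
    intro j
    rw [← Finset.sum_filter]
    have : ∀ i ∈ Finset.univ.filter (fun i => f i = g j),
        p i * q j / max (P (f i)) (Q (f i)) = q j / max (P (g j)) (Q (g j)) * p i := by
      intro i hi
      rw [(Finset.mem_filter.1 hi).2]; ring
    rw [Finset.sum_congr rfl this, ← Finset.mul_sum]
    change _ * P (g j) = _
    ring
  refine ⟨fun i j => if f i = g j then p i * q j / max (P (f i)) (Q (f i)) else 0,
    ?_, ?_, ?_, ?_, ?_, ?_⟩
  · intro i j
    dsimp only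
    split_ifs
    · exact div_nonneg (mul_nonneg (hp i) (hq j)) (le_max_of_le_left (hP0 _))
    · exact le_rfl
  · intro i j h
    simp [h]
  · intro i
    rw [hrow]
    exact mul_le_of_le_one_right (hp i)
      (div_le_one_of_le₀ (le_max_right _ _) (le_max_of_le_left (hP0 _)))
  · intro j
    rw [hcol]
    exact mul_le_of_le_one_right (hq j)
      (div_le_one_of_le₀ (le_max_left _ _) (le_max_of_le_left (hP0 _)))
  · intro t
    simp_rw [hrow]
    have : ∀ i ∈ Finset.univ.filter (fun i => f i = t),
        p i - p i * (Q (f i) / max (P (f i)) (Q (f i))) =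
          p i * (1 - Q t / max (P t) (Q t)) := by
      intro i hi
      rw [(Finset.mem_filter.1 hi).2]; ring
    rw [Finset.sum_congr rfl this, ← Finset.sum_mul]
    change P t * _ = max (P t - Q t) 0
    rcases le_total (P t) (Q t) with h | h
    · rw [max_eq_right h, max_eq_right (by linarith)]
      rcases (hQ0 t).eq_or_lt with h0 | h0
      · rw [show P t = 0 by linarith [hP0 t]]; simp
      · rw [div_self h0.ne']; simp
    · rw [max_eq_left h, max_eq_left (by linarith)]
      rcases (hP0 t).eq_or_lt with h0 | h0
      · rw [show Q t = 0 by linarith [hQ0 t], ← h0]; simp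
      · field_simp
  · intro t
    simp_rw [hcol]
    have : ∀ j ∈ Finset.univ.filter (fun j => g j = t),
        q j - q j * (P (g j) / max (P (g j)) (Q (g j))) =
          q j * (1 - P t / max (P t) (Q t)) := by
      intro i hi
      rw [(Finset.mem_filter.1 hi).2]; ring
    rw [Finset.sum_congr rfl this, ← Finset.sum_mul]
    change Q t * _ = max (Q t - P t) 0
    rcases le_total (Q t) (P t) with h | h
    · rw [max_eq_left h, max_eq_right (by linarith)]
      rcases (hP0 t).eq_or_lt with h0 | h0
      · rw [show Q t = 0 by linarith [hQ0 t]]; simp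
      · rw [div_self h0.ne']; simp
    · rw [max_eq_right h, max_eq_left (by linarith)]
      rcases (hQ0 t).eq_or_lt with h0 | h0
      · rw [show P t = 0 by linarith [hP0 t], ← h0]; simp
      · field_simp

/-- Multiscale transport bound: if the labellings `f l`, `g l` get finer with `l`, then mass is
matched from the finest scale to the coarsest one. -/
theorem exists_multiscale_coupling (c : I → J → ℝ) (h : T → T) (s : T → ℝ) (D : ℕ → ℝ)
    (B : ℕ → Finset T) (f : ℕ → I → T) (g : ℕ → J → T)
    (hf : ∀ l i, f l i = h (f (l + 1) i)) (hg : ∀ l j, g l j = h (g (l + 1) j))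
    (hfB : ∀ l i, f l i ∈ B l) (hgB : ∀ l j, g l j ∈ B l)
    (hc : ∀ l i j, f l i = g l j → c i j ≤ D l)
    (hs : ∀ i j, c i j ≤ s (f 0 i) + s (g 0 j)) (hD : ∀ l, 0 ≤ D l) (L : ℕ) :
    ∀ (p : I → ℝ) (q : J → ℝ), (∀ i, 0 ≤ p i) → (∀ j, 0 ≤ q j) → ∑ i, p i = ∑ j, q j →
      ∃ π : I → J → ℝ, (∀ i j, 0 ≤ π i j) ∧ (∀ i, ∑ j, π i j = p i) ∧ (∀ j, ∑ i, π i j = q j) ∧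
        ∑ i, ∑ j, π i j * c i j ≤ D L * ∑ i, p i +
          ∑ l ∈ Finset.range L, D l * ∑ t ∈ B (l + 1),
            |∑ i with f (l + 1) i = t, p i - ∑ j with g (l + 1) j = t, q j| +
          ∑ t ∈ B 0, s t * |∑ i with f 0 i = t, p i - ∑ j with g 0 j = t, q j| := by
  have hstep : ∀ (l : ℕ) (p : I → ℝ) (q : J → ℝ), (∀ i, 0 ≤ p i) → ∀ π : I → J → ℝ,
      (∀ i j, 0 ≤ π i j) → (∀ i j, f l i ≠ g l j → π i j = 0) → (∀ i, ∑ j, π i j ≤ p i) →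
      ∑ i, ∑ j, π i j * c i j ≤ D l * ∑ i, p i := by
    intro l p q hp π h0 hne hr
    rw [Finset.mul_sum]
    refine Finset.sum_le_sum fun i _ => ?_
    refine le_trans ?_ (mul_le_mul_of_nonneg_left (hr i) (hD l))
    rw [Finset.mul_sum]
    refine Finset.sum_le_sum fun j _ => ?_
    by_cases hij : f l i = g l j
    · rw [mul_comm]
      exact mul_le_mul_of_nonneg_right (hc l i j hij) (h0 i j)
    · simp [hne i j hij]
  have hbal : ∀ (p : I → ℝ) (q : J → ℝ) (π : I → J → ℝ), ∑ i, p i = ∑ j, q j →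
      ∑ i, (p i - ∑ j, π i j) = ∑ j, (q j - ∑ i, π i j) := by
    intro p q π hpq
    rw [Finset.sum_sub_distrib, Finset.sum_sub_distrib, hpq, Finset.sum_comm]
  have hcoarse : ∀ l t (u : I → ℝ),
      ∑ i with f l i = t, u i = ∑ b ∈ (B (l + 1)).filter (fun b => h b = t),
        ∑ i with f (l + 1) i = b, u i := by
    intro l t u
    rw [← Finset.sum_fiberwise_of_maps_to (s := Finset.univ.filter (fun i => f l i = t))
      (t := (B (l + 1)).filter (fun b => h b = t)) (g := f (l + 1))]
    · refine Finset.sum_congr rfl fun b hb => ?_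
      rw [Finset.filter_filter]
      refine Finset.sum_congr (Finset.filter_congr fun i _ => ?_) fun _ _ => rfl
      constructor
      · exact fun h => h.2
      · intro hi
        refine ⟨?_, hi⟩
        rw [hf, hi]; exact (Finset.mem_filter.1 hb).2
    · intro i hi
      rw [Finset.mem_filter] at hi ⊢
      exact ⟨hfB _ _, by rw [← hf]; exact hi.2⟩
  have hcoarse' : ∀ l t (u : J → ℝ),
      ∑ i with g l i = t, u i = ∑ b ∈ (B (l + 1)).filter (fun b => h b = t),
        ∑ i with g (l + 1) i = b, u i := by
    intro l t u
    rw [← Finset.sum_fiberwise_of_maps_to (s := Finset.univ.filter (fun i => g l i = t))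
      (t := (B (l + 1)).filter (fun b => h b = t)) (g := g (l + 1))]
    · refine Finset.sum_congr rfl fun b hb => ?_
      rw [Finset.filter_filter]
      refine Finset.sum_congr (Finset.filter_congr fun i _ => ?_) fun _ _ => rfl
      constructor
      · exact fun h => h.2
      · intro hi
        refine ⟨?_, hi⟩
        rw [hg, hi]; exact (Finset.mem_filter.1 hb).2
    · intro i hi
      rw [Finset.mem_filter] at hi ⊢
      exact ⟨hgB _ _, by rw [← hg]; exact hi.2⟩
  have hmax : ∀ u v : ℝ, max (u - v) 0 - max (v - u) 0 = u - v := by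
    intro u v
    rcases le_total u v with h | h
    · rw [max_eq_right (by linarith), max_eq_left (by linarith)]; ring
    · rw [max_eq_left (by linarith), max_eq_right (by linarith)]; ring
  induction L with
  | zero =>
    intro p q hp hq hpq
    obtain ⟨π, h0, hne, hr, hcl, hP, hQ⟩ := exists_partial_matching p q hp hq (f 0) (g 0)
    set p' : I → ℝ := fun i => p i - ∑ j, π i j with hp'
    set q' : J → ℝ := fun j => q j - ∑ i, π i j with hq'
    have hp'0 : ∀ i, 0 ≤ p' i := fun i => sub_nonneg.2 (hr i)
    have hq'0 : ∀ j, 0 ≤ q' j := fun j => sub_nonneg.2 (hcl j)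
    have hm : ∑ i, p' i = ∑ j, q' j := hbal p q π hpq
    set m := ∑ i, p' i with hmdef
    have hm0 : 0 ≤ m := Finset.sum_nonneg fun i _ => hp'0 i
    have hpm : ∀ i, p' i * m / m = p' i := by
      intro i
      rcases hm0.eq_or_lt with h | h
      · have : p' i = 0 := (Finset.sum_eq_zero_iff_of_nonneg fun i _ => hp'0 i).1 h.symm i
          (Finset.mem_univ _)
        rw [this]; simp
      · field_simp
    have hqm : ∀ j, q' j * m / m = q' j := by
      intro j
      rcases hm0.eq_or_lt with h | h
      · have : q' j = 0 := (Finset.sum_eq_zero_iff_of_nonneg fun i _ => hq'0 i).1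
          (hm.symm.trans h.symm) j (Finset.mem_univ _)
        rw [this]; simp
      · field_simp
    have hrow : ∀ i, ∑ j, p' i * q' j / m = p' i := by
      intro i
      rw [← Finset.sum_div, ← Finset.mul_sum, ← hm, hpm]
    have hcol : ∀ j, ∑ i, p' i * q' j / m = q' j := by
      intro j
      rw [← Finset.sum_div, ← Finset.sum_mul, mul_comm, hqm]
    refine ⟨fun i j => π i j + p' i * q' j / m, ?_, ?_, ?_, ?_⟩
    · intro i j
      exact add_nonneg (h0 i j) (div_nonneg (mul_nonneg (hp'0 i) (hq'0 j)) hm0)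
    · intro i
      rw [Finset.sum_add_distrib, hrow]; simp [hp']
    · intro j
      rw [Finset.sum_add_distrib, hcol]; simp [hq']
    · have h1 := hstep 0 p q hp π h0 hne hr
      have h2 : ∑ i, ∑ j, p' i * q' j / m * c i j ≤
          ∑ t ∈ B 0, s t * |∑ i with f 0 i = t, p i - ∑ j with g 0 j = t, q j| := by
        calc ∑ i, ∑ j, p' i * q' j / m * c i j
            ≤ ∑ i, ∑ j, (s (f 0 i) * (p' i * q' j / m) + s (g 0 j) * (p' i * q' j / m)) := by
              refine Finset.sum_le_sum fun i _ => Finset.sum_le_sum fun j _ => ?_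
              rw [← add_mul, mul_comm]
              exact mul_le_mul_of_nonneg_right (hs i j)
                (div_nonneg (mul_nonneg (hp'0 i) (hq'0 j)) hm0)
          _ = ∑ i, s (f 0 i) * p' i + ∑ j, s (g 0 j) * q' j := by
              simp_rw [Finset.sum_add_distrib]
              congr 1
              · simp_rw [← Finset.mul_sum, hrow]
              · rw [Finset.sum_comm]
                simp_rw [← Finset.mul_sum, hcol]
          _ = ∑ t ∈ B 0, s t * |∑ i with f 0 i = t, p i - ∑ j with g 0 j = t, q j| := by
              rw [← Finset.sum_fiberwise_of_maps_to (s := Finset.univ) (t := B 0) (g := f 0)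
                (fun i _ => hfB 0 i), ← Finset.sum_fiberwise_of_maps_to (s := Finset.univ)
                (t := B 0) (g := g 0) (fun i _ => hgB 0 i), ← Finset.sum_add_distrib]
              refine Finset.sum_congr rfl fun t _ => ?_
              have e1 : ∑ i with f 0 i = t, s (f 0 i) * p' i = s t * ∑ i with f 0 i = t, p' i := by
                rw [Finset.mul_sum]
                exact Finset.sum_congr rfl fun i hi => by rw [(Finset.mem_filter.1 hi).2]
              have e2 : ∑ i with g 0 i = t, s (g 0 i) * q' i = s t * ∑ i with g 0 i = t, q' i := by
                rw [Finset.mul_sum]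
                exact Finset.sum_congr rfl fun i hi => by rw [(Finset.mem_filter.1 hi).2]
              rw [e1, e2, ← mul_add]
              congr 1
              rw [hP, hQ]
              rcases le_total (∑ i with f 0 i = t, p i) (∑ j with g 0 j = t, q j) with h | h
              · rw [max_eq_right (by linarith), max_eq_left (by linarith),
                  abs_of_nonpos (by linarith)]
                ring
              · rw [max_eq_left (by linarith), max_eq_right (by linarith),
                  abs_of_nonneg (by linarith)]
                ring
      simp_rw [add_mul, Finset.sum_add_distrib]
      simp only [Finset.range_zero, Finset.sum_empty]
      linarith
  | succ L ih =>
    intro p q hp hq hpq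
    obtain ⟨π, h0, hne, hr, hcl, hP, hQ⟩ :=
      exists_partial_matching p q hp hq (f (L + 1)) (g (L + 1))
    obtain ⟨π', h0', hr', hc', hcost⟩ := ih (fun i => p i - ∑ j, π i j) (fun j => q j - ∑ i, π i j)
      (fun i => sub_nonneg.2 (hr i)) (fun j => sub_nonneg.2 (hcl j)) (hbal p q π hpq)
    refine ⟨fun i j => π i j + π' i j, fun i j => add_nonneg (h0 i j) (h0' i j), ?_, ?_, ?_⟩
    · intro i
      rw [Finset.sum_add_distrib, hr']; ring
    · intro j
      rw [Finset.sum_add_distrib, hc']; ring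
    · have h1 := hstep (L + 1) p q hp π h0 hne hr
      have hdiff : ∀ k l, k + l = L + 1 → ∀ t,
          ∑ i with f l i = t, (p i - ∑ j, π i j) - ∑ j with g l j = t, (q j - ∑ i, π i j) =
            ∑ i with f l i = t, p i - ∑ j with g l j = t, q j := by
        intro k
        induction k with
        | zero =>
          intro l hl t
          rw [zero_add] at hl
          subst hl
          rw [hP, hQ, hmax]
        | succ k ihk =>
          intro l hl t
          have := ihk (l + 1) (by omega)
          rw [hcoarse l t, hcoarse' l t, hcoarse l t p, hcoarse' l t q,
            ← Finset.sum_sub_distrib, ← Finset.sum_sub_distrib]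
          exact Finset.sum_congr rfl fun b _ => this b
      have hmass : ∑ i, (p i - ∑ j, π i j) ≤ ∑ t ∈ B (L + 1),
          |∑ i with f (L + 1) i = t, p i - ∑ j with g (L + 1) j = t, q j| := by
        rw [← Finset.sum_fiberwise_of_maps_to (s := Finset.univ) (t := B (L + 1))
          (g := f (L + 1)) (fun i _ => hfB _ i)]
        refine Finset.sum_le_sum fun t _ => ?_
        rw [hP]
        exact max_le (le_abs_self _) (abs_nonneg _)
      have hmass' := mul_le_mul_of_nonneg_left hmass (hD L)
      rw [Finset.sum_congr rfl (g := fun l => D l * ∑ t ∈ B (l + 1),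
            |∑ i with f (l + 1) i = t, p i - ∑ j with g (l + 1) j = t, q j|)
          (fun l hl => by
            congr 1
            refine Finset.sum_congr rfl fun t _ => ?_
            rw [hdiff (L - l) (l + 1) (by have := Finset.mem_range.1 hl; omega)]),
        Finset.sum_congr rfl (g := fun t => s t *
            |∑ i with f 0 i = t, p i - ∑ j with g 0 j = t, q j|)
          (fun t _ => by rw [hdiff (L + 1) 0 (by omega)])] at hcost
      simp_rw [add_mul, Finset.sum_add_distrib]
      rw [Finset.sum_range_succ]
      linarith

end FiniteTransport

section Allocation

variable {n N : ℕ}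

/-- The ways to split `μ` into `N` parts of equal mass `1/N`. -/
def allocations (N : ℕ) (μ : Measure (Fin n → ℝ)) : Set (Fin N → Measure (Fin n → ℝ)) :=
  {ν | ∑ j, ν j = μ ∧ ∀ j, ν j Set.univ = (N : ℝ≥0∞)⁻¹}

/-- The least cost of transporting `μ` to the points `x j`, each of which receives mass `1/N`. -/
noncomputable def allocationCost (μ : Measure (Fin n → ℝ)) (x : Fin N → (Fin n → ℝ)) : ℝ :=
  ⨅ ν : allocations N μ, ∑ j, ∫ ξ, l1norm (ξ - x j) ∂(ν.1 j)

variable {μ : Measure (Fin n → ℝ)}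

lemma le_of_mem_allocations {ν : Fin N → Measure (Fin n → ℝ)} (hν : ν ∈ allocations N μ)
    (j : Fin N) : ν j ≤ μ := by
  rw [← hν.1]
  refine Measure.le_iff.2 fun s _ => ?_
  rw [Measure.finsetSum_apply]
  exact Finset.single_le_sum (f := fun j => ν j s) (fun _ _ => zero_le) (Finset.mem_univ j)

lemma integrable_l1norm_sub [IsFiniteMeasure μ] (hμ : Integrable l1norm μ) (y : Fin n → ℝ) :
    Integrable (fun ξ => l1norm (ξ - y)) μ := by
  refine Integrable.mono' (hμ.add (integrable_const (l1norm y)))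
    (continuous_l1norm.comp (continuous_id.sub continuous_const)).aestronglyMeasurable
    (Filter.Eventually.of_forall fun ξ => ?_)
  rw [Real.norm_of_nonneg (l1norm_nonneg _)]
  exact l1norm_sub_le _ _

lemma isFiniteMeasure_of_mem_allocations [IsFiniteMeasure μ] {ν : Fin N → Measure (Fin n → ℝ)}
    (hν : ν ∈ allocations N μ) (j : Fin N) : IsFiniteMeasure (ν j) :=
  isFiniteMeasure_of_le μ (le_of_mem_allocations hν j)

lemma allocations_const_mem (hN : 1 ≤ N) [IsProbabilityMeasure μ] :
    (fun _ : Fin N => (N : ℝ≥0∞)⁻¹ • μ) ∈ allocations N μ := by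
  have hN0 : (N : ℝ≥0∞) ≠ 0 := by
    rw [Nat.cast_ne_zero]; omega
  refine ⟨?_, fun j => by simp⟩
  rw [Finset.sum_const, Finset.card_univ, Fintype.card_fin, ← Nat.cast_smul_eq_nsmul ℝ≥0∞,
    smul_smul, ENNReal.mul_inv_cancel hN0 (ENNReal.natCast_ne_top N), one_smul]

lemma bddBelow_allocationCost (x : Fin N → (Fin n → ℝ)) :
    BddBelow (Set.range fun ν : allocations N μ => ∑ j, ∫ ξ, l1norm (ξ - x j) ∂(ν.1 j)) :=
  ⟨0, by
    rintro _ ⟨ν, rfl⟩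
    exact Finset.sum_nonneg fun j _ => integral_nonneg fun ξ => l1norm_nonneg _⟩

lemma allocationCost_nonneg (x : Fin N → (Fin n → ℝ)) : 0 ≤ allocationCost μ x :=
  Real.iInf_nonneg fun _ => Finset.sum_nonneg fun _ _ => integral_nonneg fun _ => l1norm_nonneg _

lemma le_allocationCost_of_le_W1 (hN : 1 ≤ N) [IsProbabilityMeasure μ] (hμ : Integrable l1norm μ)
    (x : Fin N → (Fin n → ℝ)) {ε : ℝ} (h : ENNReal.ofReal ε ≤ W1 μ (empirical x)) :
    ε ≤ allocationCost μ x := by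
  have : Nonempty (allocations N μ) := ⟨⟨_, allocations_const_mem hN⟩⟩
  refine le_ciInf fun ν => ?_
  obtain ⟨ν, hν⟩ := ν
  have hcost : 0 ≤ ∑ j, ∫ ξ, l1norm (ξ - x j) ∂(ν j) :=
    Finset.sum_nonneg fun j _ => integral_nonneg fun ξ => l1norm_nonneg _
  rw [← ENNReal.ofReal_le_ofReal_iff hcost]
  refine h.trans ?_
  have hmeas : ∀ j, Measurable fun ξ : Fin n → ℝ => (ξ, x j) := fun j =>
    measurable_id.prodMk measurable_const
  have hmem : ∑ j, (ν j).map (fun ξ => (ξ, x j)) ∈ couplings μ (empirical x) := by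
    refine ⟨?_, ?_⟩
    · refine Measure.ext fun s hs => ?_
      rw [Measure.map_apply measurable_fst hs, Measure.finsetSum_apply, ← hν.1,
        Measure.finsetSum_apply]
      refine Finset.sum_congr rfl fun j _ => ?_
      rw [Measure.map_apply (hmeas j) (measurable_fst hs)]
      rfl
    · refine Measure.ext fun s hs => ?_
      rw [Measure.map_apply measurable_snd hs, Measure.finsetSum_apply, empirical,
        Measure.smul_apply, Measure.finsetSum_apply, smul_eq_mul, Finset.mul_sum]
      refine Finset.sum_congr rfl fun j _ => ?_
      rw [Measure.map_apply (hmeas j) (measurable_snd hs), Measure.dirac_apply' _ hs]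
      by_cases hx : x j ∈ s
      · have : (fun ξ : Fin n → ℝ => (ξ, x j)) ⁻¹' (Prod.snd ⁻¹' s) = Set.univ := by
          ext; simp [hx]
        rw [this, hν.2 j]; simp [hx]
      · have : (fun ξ : Fin n → ℝ => (ξ, x j)) ⁻¹' (Prod.snd ⁻¹' s) = ∅ := by
          ext; simp [hx]
        rw [this]; simp [hx]
  refine (iInf₂_le _ hmem).trans ?_
  rw [lintegral_finsetSum_measure, ENNReal.ofReal_sum_of_nonneg
    (fun j _ => integral_nonneg fun ξ => l1norm_nonneg _)]
  refine Finset.sum_le_sum fun j _ => ?_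
  · rw [lintegral_map _ (hmeas j), ofReal_integral_eq_lintegral_ofReal
      ((integrable_l1norm_sub hμ (x j)).mono_measure (le_of_mem_allocations hν j))
      (Filter.Eventually.of_forall fun ξ => l1norm_nonneg _)]
    exact (measurable_l1norm.comp (measurable_fst.sub measurable_snd)).ennreal_ofReal

lemma allocationCost_le_add (hN : 1 ≤ N) [IsProbabilityMeasure μ] (hμ : Integrable l1norm μ)
    (x y : Fin N → (Fin n → ℝ)) :
    allocationCost μ x ≤ allocationCost μ y + ∑ j, (N : ℝ)⁻¹ * l1norm (x j - y j) := by
  have : Nonempty (allocations N μ) := ⟨⟨_, allocations_const_mem hN⟩⟩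
  rw [← sub_le_iff_le_add]
  refine le_ciInf fun ν => ?_
  rw [sub_le_iff_le_add]
  refine (ciInf_le (bddBelow_allocationCost x) ν).trans ?_
  rw [← Finset.sum_add_distrib]
  refine Finset.sum_le_sum fun j _ => ?_
  have := isFiniteMeasure_of_mem_allocations ν.2 j
  have hi : ∀ z, Integrable (fun ξ => l1norm (ξ - z)) (ν.1 j) := fun z =>
    (integrable_l1norm_sub hμ z).mono_measure (le_of_mem_allocations ν.2 j)
  calc ∫ ξ, l1norm (ξ - x j) ∂(ν.1 j)
      ≤ ∫ ξ, (l1norm (ξ - y j) + l1norm (x j - y j)) ∂(ν.1 j) := by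
        refine integral_mono (hi _) ((hi _).add (integrable_const _)) fun ξ => ?_
        rw [l1norm_sub_comm (x j)]
        exact l1norm_sub_le_sub_add_sub _ _ _
    _ = _ := by
        rw [integral_add (hi _) (integrable_const _), integral_const, smul_eq_mul, measureReal_def,
          ν.2.2 j]
        simp

lemma abs_allocationCost_sub_le (hN : 1 ≤ N) [IsProbabilityMeasure μ] (hμ : Integrable l1norm μ)
    (x y : Fin N → (Fin n → ℝ)) :
    |allocationCost μ x - allocationCost μ y| ≤ ∑ j, (N : ℝ)⁻¹ * l1norm (x j - y j) := by
  rw [abs_sub_le_iff]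
  refine ⟨by linarith [allocationCost_le_add hN hμ x y], ?_⟩
  have := allocationCost_le_add hN hμ y x
  simp_rw [l1norm_sub_comm (y _)] at this
  linarith

lemma continuous_allocationCost (hN : 1 ≤ N) [IsProbabilityMeasure μ]
    (hμ : Integrable l1norm μ) :
    Continuous (allocationCost μ : (Fin N → (Fin n → ℝ)) → ℝ) := by
  refine continuous_iff_continuousAt.2 fun y => ?_
  rw [ContinuousAt, tendsto_iff_dist_tendsto_zero]
  refine squeeze_zero (fun _ => dist_nonneg) (fun x => abs_allocationCost_sub_le hN hμ x y) ?_
  have hc : Continuous fun x : Fin N → (Fin n → ℝ) => ∑ j, (N : ℝ)⁻¹ * l1norm (x j - y j) :=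
    continuous_finsetSum _ fun j _ => continuous_const.mul
      (continuous_l1norm.comp ((continuous_apply j).sub continuous_const))
  have := hc.tendsto y
  simpa [l1norm_zero] using this

end Allocation

section Dyadic

variable {n N : ℕ}

/-- The label of the dyadic cube of side `2⁻ˡ` that contains `x`. -/
noncomputable def dyadicLabel (l : ℕ) (x : Fin n → ℝ) : Fin n → ℤ := fun i => ⌊2 ^ l * x i⌋

/-- The lower corner of the dyadic cube of side `2⁻ˡ` with label `t`. -/
noncomputable def dyadicCorner (l : ℕ) (t : Fin n → ℤ) : Fin n → ℝ := fun i => t i / 2 ^ l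

/-- The labels of the dyadic cubes of side `2⁻ˡ` inside `[-M, M)ⁿ`. -/
noncomputable def dyadicBox (n M l : ℕ) : Finset (Fin n → ℤ) :=
  Fintype.piFinset fun _ => Finset.Ico (-(M * 2 ^ l : ℤ)) (M * 2 ^ l)

/-- A bound for the `ℓ₁`-norm on the unit cube with label `t`. -/
def cubeNorm (t : Fin n → ℤ) : ℝ := ∑ i, (|(t i : ℝ)| + 1)

lemma dyadicLabel_succ (l : ℕ) (x : Fin n → ℝ) :
    dyadicLabel l x = fun i => dyadicLabel (l + 1) x i / 2 := by
  funext i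
  have := Int.floor_div_natCast (2 ^ (l + 1) * x i) 2
  rw [dyadicLabel, dyadicLabel]
  push_cast at this
  rw [← this]
  congr 1
  ring

lemma dyadicLabel_corner (l : ℕ) (t : Fin n → ℤ) : dyadicLabel l (dyadicCorner l t) = t := by
  funext i
  rw [dyadicLabel, dyadicCorner, mul_div_cancel₀ _ (by positivity), Int.floor_intCast]

lemma dyadicLabel_eq_of_le {l L : ℕ} (hl : l ≤ L) {x y : Fin n → ℝ}
    (h : dyadicLabel L x = dyadicLabel L y) : dyadicLabel l x = dyadicLabel l y := by
  induction L, hl using Nat.le_induction with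
  | base => exact h
  | succ L _ ih =>
    apply ih
    rw [dyadicLabel_succ L x, dyadicLabel_succ L y, h]

lemma measurable_dyadicLabel (l : ℕ) :
    Measurable (dyadicLabel l : (Fin n → ℝ) → (Fin n → ℤ)) :=
  measurable_pi_lambda _ fun i => (measurable_const.mul (measurable_pi_apply i)).floor

lemma dyadicLabel_mem_box {M : ℕ} (l : ℕ) {x : Fin n → ℝ}
    (hx : ∀ i, -(M : ℝ) ≤ x i ∧ x i < M) : dyadicLabel l x ∈ dyadicBox n M l := by
  rw [dyadicBox, Fintype.mem_piFinset]
  intro i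
  rw [Finset.mem_Ico, dyadicLabel, Int.le_floor, Int.floor_lt]
  push_cast
  have h2 : (0 : ℝ) < 2 ^ l := by positivity
  constructor
  · nlinarith [(hx i).1]
  · nlinarith [(hx i).2]

lemma dyadicCorner_mem {M l : ℕ} {t : Fin n → ℤ} (ht : t ∈ dyadicBox n M l) (i : Fin n) :
    -(M : ℝ) ≤ dyadicCorner l t i ∧ dyadicCorner l t i < M := by
  rw [dyadicBox, Fintype.mem_piFinset] at ht
  have h := Finset.mem_Ico.1 (ht i)
  have h2 : (0 : ℝ) < 2 ^ l := by positivity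
  rw [dyadicCorner, le_div_iff₀ h2, div_lt_iff₀ h2]
  constructor
  · rw [neg_mul]; exact_mod_cast h.1
  · exact_mod_cast h.2

lemma l1norm_sub_le_of_dyadicLabel_eq {l : ℕ} {x y : Fin n → ℝ}
    (h : dyadicLabel l x = dyadicLabel l y) : l1norm (x - y) ≤ n / 2 ^ l := by
  have : ∀ i ∈ Finset.univ, |(x - y) i| ≤ 1 / 2 ^ l := by
    intro i _
    have hi : ⌊2 ^ l * x i⌋ = ⌊2 ^ l * y i⌋ := congrFun h i
    have h1 := Int.abs_sub_lt_one_of_floor_eq_floor hi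
    have h2 : (0 : ℝ) < 2 ^ l := by positivity
    rw [le_div_iff₀ h2, ← abs_of_pos h2, ← abs_mul, Pi.sub_apply, mul_comm, mul_sub]
    exact h1.le
  refine (Finset.sum_le_sum this).trans_eq ?_
  simp [div_eq_mul_inv]

lemma l1norm_le_cubeNorm (x : Fin n → ℝ) : l1norm x ≤ cubeNorm (dyadicLabel 0 x) := by
  refine Finset.sum_le_sum fun i _ => ?_
  rw [dyadicLabel, pow_zero, one_mul]
  have h1 := Int.floor_le (x i)
  have h2 := Int.lt_floor_add_one (x i)
  have h3 : |x i - ⌊x i⌋| ≤ 1 := by rw [abs_le]; constructor <;> linarith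
  calc |x i| = |(⌊x i⌋ : ℝ) + (x i - ⌊x i⌋)| := by ring_nf
    _ ≤ |(⌊x i⌋ : ℝ)| + |x i - ⌊x i⌋| := abs_add_le _ _
    _ ≤ _ := by linarith

/-- The mass discrepancy between `μ` and the empirical distribution of `x` on the dyadic cube of
side `2⁻ˡ` with label `t`. -/
noncomputable def dyadicDiscrepancy (μ : Measure (Fin n → ℝ)) (x : Fin N → (Fin n → ℝ)) (l : ℕ)
    (t : Fin n → ℤ) : ℝ :=
  |μ.real (dyadicLabel l ⁻¹' {t}) - ∑ j with dyadicLabel l (x j) = t, (N : ℝ)⁻¹|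

theorem allocationCost_le_dyadic (hN : 1 ≤ N) {μ : Measure (Fin n → ℝ)} [IsProbabilityMeasure μ]
    {M : ℕ} (hM : ∀ᵐ ξ ∂μ, ∀ i, -(M : ℝ) ≤ ξ i ∧ ξ i < (M : ℝ)) (hμ : Integrable l1norm μ)
    (x : Fin N → (Fin n → ℝ)) (hx : ∀ j i, -(M : ℝ) ≤ x j i ∧ x j i < M) (L : ℕ) :
    allocationCost μ x ≤ 2 * (n / 2 ^ L) +
      ∑ l ∈ Finset.range L, n / 2 ^ l *
        ∑ t ∈ dyadicBox n M (l + 1), dyadicDiscrepancy μ x (l + 1) t +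
      ∑ t ∈ dyadicBox n M 0, cubeNorm t * dyadicDiscrepancy μ x 0 t := by
  have hN0 : (0 : ℝ) < N := by exact_mod_cast hN
  let I := ↥(dyadicBox n M L)
  let a : I → (Fin n → ℝ) := fun i => dyadicCorner L i.1
  let Q : I → Set (Fin n → ℝ) := fun i => dyadicLabel L ⁻¹' {i.1}
  have hQ : ∀ i, MeasurableSet (Q i) := fun i =>
    measurable_dyadicLabel L (measurableSet_singleton _)
  let p : I → ℝ := fun i => μ.real (Q i)
  have hmass : ∀ l ≤ L, ∀ t, ∑ i : I with dyadicLabel l (a i) = t, p i =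
      μ.real (dyadicLabel l ⁻¹' {t}) := by
    intro l hl t
    have h1 : ∑ i : I with dyadicLabel l (a i) = t, p i =
        ∑ i ∈ (dyadicBox n M L).filter (fun i => dyadicLabel l (dyadicCorner L i) = t),
          μ.real (dyadicLabel L ⁻¹' {i}) := by
      rw [Finset.sum_filter, Finset.sum_filter]
      exact Finset.sum_coe_sort (dyadicBox n M L) fun i =>
        if dyadicLabel l (dyadicCorner L i) = t then μ.real (dyadicLabel L ⁻¹' {i}) else 0
    rw [h1, sum_measureReal_preimage_singleton _
      (fun y _ => measurable_dyadicLabel L (measurableSet_singleton y))]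
    refine measureReal_congr ?_
    filter_upwards [hM] with ξ hξ
    refine propext ?_
    change dyadicLabel L ξ ∈ ((dyadicBox n M L).filter _ : Finset _) ↔ dyadicLabel l ξ = t
    rw [Finset.mem_filter,
      dyadicLabel_eq_of_le hl (dyadicLabel_corner L (dyadicLabel L ξ))]
    exact ⟨fun h => h.2, fun h => ⟨dyadicLabel_mem_box L hξ, h⟩⟩
  have hsumrestrict : ∑ i, μ.restrict (Q i) = μ := by
    refine Measure.ext fun s hs => ?_
    rw [Measure.finsetSum_apply]
    simp_rw [Measure.restrict_apply hs]
    rw [← measure_biUnion_finset]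
    · refine measure_congr ?_
      filter_upwards [hM] with ξ hξ
      refine propext ?_
      change ξ ∈ (⋃ b ∈ Finset.univ, s ∩ Q b) ↔ ξ ∈ s
      simp only [Finset.mem_univ, Set.iUnion_true, Set.mem_iUnion]
      exact ⟨fun ⟨i, hi⟩ => hi.1, fun h => ⟨⟨_, dyadicLabel_mem_box L hξ⟩, h, rfl⟩⟩
    · intro i _ j _ hij
      refine Set.disjoint_left.2 fun ξ h1 h2 => hij ?_
      exact Subtype.ext (h1.2.symm.trans h2.2)
    · exact fun i _ => hs.inter (hQ i)
  have hpsum : ∑ i, p i = 1 := by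
    have := congrArg (fun m : Measure (Fin n → ℝ) => m.real Set.univ) hsumrestrict
    simp only [probReal_univ] at this
    rw [← this, measureReal_def, Measure.finsetSum_apply,
      ENNReal.toReal_sum (fun i _ => measure_ne_top _ _)]
    simp [p, measureReal_def]
  obtain ⟨π, h0, hrow, hcol, hcost⟩ := exists_multiscale_coupling
    (fun (i : I) (j : Fin N) => l1norm (a i - x j)) (fun (t : Fin n → ℤ) i => t i / 2) cubeNorm
    (fun l => n / 2 ^ l) (dyadicBox n M) (fun l i => dyadicLabel l (a i))
    (fun l j => dyadicLabel l (x j)) (fun l i => dyadicLabel_succ l _)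
    (fun l j => dyadicLabel_succ l _)
    (fun l i => dyadicLabel_mem_box l (dyadicCorner_mem i.2))
    (fun l j => dyadicLabel_mem_box l (hx j))
    (fun l i j h => l1norm_sub_le_of_dyadicLabel_eq h)
    (fun i j => (l1norm_sub_le _ _).trans
      (add_le_add (l1norm_le_cubeNorm _) (l1norm_le_cubeNorm _)))
    (fun l => by positivity) L p (fun _ => (N : ℝ)⁻¹) (fun i => measureReal_nonneg)
    (fun j => by positivity)
    (by rw [hpsum]; simp [hN0.ne'])
  have hπ0 : ∀ i j, p i = 0 → π i j = 0 := by
    intro i j hi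
    exact (Finset.sum_eq_zero_iff_of_nonneg fun j _ => h0 i j).1 ((hrow i).trans hi) j
      (Finset.mem_univ _)
  have hpdiv : ∀ i j, π i j / p i * p i = π i j := by
    intro i j
    by_cases hi : p i = 0
    · rw [hi, hπ0 i j hi]; simp
    · field_simp
  have hμQ : ∀ i, μ (Q i) = ENNReal.ofReal (p i) := fun i => by
    simp [p, measureReal_def, ENNReal.ofReal_toReal (measure_ne_top _ _)]
  let ν : Fin N → Measure (Fin n → ℝ) := fun j =>
    ∑ i, ENNReal.ofReal (π i j / p i) • μ.restrict (Q i)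
  have hw0 : ∀ i j, 0 ≤ π i j / p i := fun i j => div_nonneg (h0 i j) measureReal_nonneg
  have hν : ν ∈ allocations N μ := by
    constructor
    · change ∑ j, ∑ i, _ = μ
      rw [Finset.sum_comm]
      conv_rhs => rw [← hsumrestrict]
      refine Finset.sum_congr rfl fun i _ => ?_
      rw [← Finset.sum_smul, ← ENNReal.ofReal_sum_of_nonneg (fun j _ => hw0 i j),
        ← Finset.sum_div, hrow]
      by_cases hi : p i = 0
      · have : μ.restrict (Q i) = 0 := by
          rw [Measure.restrict_eq_zero, hμQ, hi, ENNReal.ofReal_zero]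
        rw [this, smul_zero]
      · rw [div_self hi, ENNReal.ofReal_one, one_smul]
    · intro j
      change (∑ i, _ : Measure (Fin n → ℝ)) _ = _
      rw [Measure.finsetSum_apply]
      simp only [Measure.smul_apply, Measure.restrict_apply_univ, smul_eq_mul, hμQ]
      simp_rw [← ENNReal.ofReal_mul (hw0 _ _), hpdiv]
      rw [← ENNReal.ofReal_sum_of_nonneg (fun i _ => h0 i j), hcol, ENNReal.ofReal_inv_of_pos hN0,
        ENNReal.ofReal_natCast]
  refine (ciInf_le (bddBelow_allocationCost x) ⟨ν, hν⟩).trans ?_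
  have hint : ∀ i j, Integrable (fun ξ => l1norm (ξ - x j)) (μ.restrict (Q i)) := fun i j =>
    (integrable_l1norm_sub hμ (x j)).restrict
  have hcell : ∀ i j, ∫ ξ in Q i, l1norm (ξ - x j) ∂μ ≤ (n / 2 ^ L + l1norm (a i - x j)) * p i := by
    intro i j
    calc ∫ ξ in Q i, l1norm (ξ - x j) ∂μ ≤ ∫ ξ in Q i, (n / 2 ^ L + l1norm (a i - x j)) ∂μ := by
          refine setIntegral_mono_on (hint i j) (integrable_const _) (hQ i) fun ξ hξ => ?_
          refine (l1norm_sub_le_sub_add_sub ξ (a i) (x j)).trans (add_le_add_left ?_ _)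
          refine l1norm_sub_le_of_dyadicLabel_eq ?_
          rw [dyadicLabel_corner]
          exact hξ
      _ = _ := by
          rw [setIntegral_const, smul_eq_mul, mul_comm]
  have hcostν : ∑ j, ∫ ξ, l1norm (ξ - x j) ∂(ν j) ≤
      n / 2 ^ L + ∑ i, ∑ j, π i j * l1norm (a i - x j) := by
    calc ∑ j, ∫ ξ, l1norm (ξ - x j) ∂(ν j)
        = ∑ j, ∑ i, π i j / p i * ∫ ξ in Q i, l1norm (ξ - x j) ∂μ := by
          refine Finset.sum_congr rfl fun j _ => ?_
          change ∫ ξ, _ ∂(∑ i, _) = _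
          rw [integral_finsetSum_measure
            (fun i _ => (hint i j).smul_measure ENNReal.ofReal_ne_top)]
          refine Finset.sum_congr rfl fun i _ => ?_
          rw [integral_smul_measure, ENNReal.toReal_ofReal (hw0 i j), smul_eq_mul]
      _ ≤ ∑ j, ∑ i, (n / 2 ^ L * π i j + π i j * l1norm (a i - x j)) := by
          refine Finset.sum_le_sum fun j _ => Finset.sum_le_sum fun i _ => ?_
          refine (mul_le_mul_of_nonneg_left (hcell i j) (hw0 i j)).trans_eq ?_
          rw [mul_comm _ (p i), ← mul_assoc, hpdiv]
          ring
      _ = _ := by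
          rw [Finset.sum_comm]
          simp_rw [Finset.sum_add_distrib, ← Finset.mul_sum, hrow]
          rw [hpsum, mul_one]
  refine hcostν.trans ?_
  have e1 : ∀ l ∈ Finset.range L, (n : ℝ) / 2 ^ l * ∑ t ∈ dyadicBox n M (l + 1),
        |∑ i : I with dyadicLabel (l + 1) (a i) = t, p i -
          ∑ j with dyadicLabel (l + 1) (x j) = t, (N : ℝ)⁻¹| =
      n / 2 ^ l * ∑ t ∈ dyadicBox n M (l + 1), dyadicDiscrepancy μ x (l + 1) t := by
    intro l hl
    congr 1
    refine Finset.sum_congr rfl fun t _ => ?_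
    rw [hmass (l + 1) (Finset.mem_range.1 hl), dyadicDiscrepancy]
  have e2 : ∀ t ∈ dyadicBox n M 0, cubeNorm t * |∑ i : I with dyadicLabel 0 (a i) = t, p i -
          ∑ j with dyadicLabel 0 (x j) = t, (N : ℝ)⁻¹| =
      cubeNorm t * dyadicDiscrepancy μ x 0 t := by
    intro t _
    rw [hmass 0 (Nat.zero_le _), dyadicDiscrepancy]
  rw [Finset.sum_congr rfl e1, Finset.sum_congr rfl e2, hpsum] at hcost
  linarith

end Dyadic

section Tensorization

variable {E : Type*} [MeasurableSpace E]

/-- Exponential moments of functions that are Lipschitz in each coordinate tensorize. -/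
theorem integral_exp_sub_integral_pi_le (μ : Measure E) [IsProbabilityMeasure μ] (d : E → E → ℝ)
    (hd : ∀ y, d y y = 0) (t c : ℝ) (hc0 : 0 ≤ c)
    (h1 : ∀ h : E → ℝ, Measurable h → (∃ B, ∀ y, |h y| ≤ B) → (∀ y z, |h y - h z| ≤ d y z) →
      ∫ y, Real.exp (t * (h y - ∫ z, h z ∂μ)) ∂μ ≤ c) :
    ∀ (N : ℕ) (G : (Fin N → E) → ℝ), Measurable G → (∃ B, ∀ x, |G x| ≤ B) →
      (∀ x y, |G x - G y| ≤ ∑ j, d (x j) (y j)) →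
      ∫ x, Real.exp (t * (G x - ∫ y, G y ∂(Measure.pi fun _ => μ))) ∂(Measure.pi fun _ => μ) ≤
        c ^ N := by
  intro N
  induction N with
  | zero =>
    intro G hG hB _
    have : ∀ x, G x = G default := fun x => congrArg G (Subsingleton.elim _ _)
    simp [this]
  | succ N ih =>
    intro G hG ⟨B, hB⟩ hL
    let ρ : Measure (Fin N → E) := Measure.pi fun _ => μ
    let e := MeasurableEquiv.piFinSuccAbove (fun _ : Fin (N + 1) => E) 0
    have he : MeasurePreserving e (Measure.pi fun _ => μ) (μ.prod ρ) :=
      measurePreserving_piFinSuccAbove (fun _ : Fin (N + 1) => μ) 0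
    let H : E × (Fin N → E) → ℝ := fun z => G (e.symm z)
    have hH : Measurable H := hG.comp e.symm.measurable
    have hGH : ∀ x, G x = H (e x) := fun x => by simp [H]
    have hHB : ∀ z, |H z| ≤ B := fun z => hB _
    have hHL : ∀ y y' x x', |H (y, x) - H (y', x')| ≤ d y y' + ∑ j, d (x j) (x' j) := by
      intro y y' x x'
      have := hL (e.symm (y, x)) (e.symm (y', x'))
      rw [Fin.sum_univ_succ] at this
      simpa [e, H, MeasurableEquiv.piFinSuccAbove] using this
    have hint : ∀ F : (Fin (N + 1) → E) → ℝ, ∫ x, F x ∂(Measure.pi fun _ => μ) =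
        ∫ z, F (e.symm z) ∂(μ.prod ρ) := by
      intro F
      rw [← he.integral_comp' (g := fun z => F (e.symm z))]
      simp
    rw [hint, hint]
    change ∫ z, Real.exp (t * (H z - ∫ z, H z ∂(μ.prod ρ))) ∂(μ.prod ρ) ≤ _
    set m := ∫ z, H z ∂(μ.prod ρ) with hm
    have hHi : Integrable H (μ.prod ρ) :=
      Integrable.of_bound hH.aestronglyMeasurable B
        (Filter.Eventually.of_forall fun z => by rw [Real.norm_eq_abs]; exact hHB z)
    have hHyi : ∀ y, Integrable (fun x => H (y, x)) ρ := fun y =>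
      Integrable.of_bound (hH.comp measurable_prodMk_left).aestronglyMeasurable B
        (Filter.Eventually.of_forall fun z => by rw [Real.norm_eq_abs]; exact hHB _)
    let G₁ : E → ℝ := fun y => ∫ x, H (y, x) ∂ρ
    have hG₁ : Measurable G₁ :=
      (hH.stronglyMeasurable.integral_prod_right' (ν := ρ)).measurable
    have hG₁B : ∀ y, |G₁ y| ≤ B := fun y => by
      have := norm_integral_le_of_norm_le_const (μ := ρ) (f := fun x => H (y, x)) (C := B)
        (Filter.Eventually.of_forall fun x => by rw [Real.norm_eq_abs]; exact hHB _)
      simpa using this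
    have hmG₁ : m = ∫ y, G₁ y ∂μ := integral_prod _ hHi
    have hG₁L : ∀ y z, |G₁ y - G₁ z| ≤ d y z := by
      intro y z
      rw [← integral_sub (hHyi y) (hHyi z)]
      have := norm_integral_le_of_norm_le_const (μ := ρ) (f := fun x => H (y, x) - H (z, x))
        (C := d y z) (Filter.Eventually.of_forall fun x => by
          rw [Real.norm_eq_abs]
          simpa [hd] using hHL y z x x)
      simpa using this
    have hexpi : Integrable (fun z => Real.exp (t * (H z - m))) (μ.prod ρ) := by
      refine Integrable.of_bound (C := Real.exp (|t| * (B + |m|))) ?_ ?_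
      · exact (((hH.sub_const m).const_mul t).exp).aestronglyMeasurable
      · refine Filter.Eventually.of_forall fun z => ?_
        rw [Real.norm_of_nonneg (Real.exp_pos _).le]
        refine Real.exp_le_exp.2 ((le_abs_self _).trans ?_)
        rw [abs_mul]
        exact mul_le_mul_of_nonneg_left ((abs_sub _ _).trans (by linarith [hHB z])) (abs_nonneg t)
    have hexp₁ : Integrable (fun y => Real.exp (t * (G₁ y - m))) μ := by
      refine Integrable.of_bound (C := Real.exp (|t| * (B + |m|))) ?_ ?_
      · exact (((hG₁.sub_const m).const_mul t).exp).aestronglyMeasurable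
      · refine Filter.Eventually.of_forall fun z => ?_
        rw [Real.norm_of_nonneg (Real.exp_pos _).le]
        refine Real.exp_le_exp.2 ((le_abs_self _).trans ?_)
        rw [abs_mul]
        exact mul_le_mul_of_nonneg_left ((abs_sub _ _).trans (by linarith [hG₁B z])) (abs_nonneg t)
    rw [integral_prod _ hexpi]
    calc ∫ y, ∫ x, Real.exp (t * (H (y, x) - m)) ∂ρ ∂μ
        ≤ ∫ y, c ^ N * Real.exp (t * (G₁ y - m)) ∂μ := by
          refine integral_mono hexpi.integral_prod_left (hexp₁.const_mul _) fun y => ?_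
          have : ∀ x, Real.exp (t * (H (y, x) - m)) =
              Real.exp (t * (H (y, x) - G₁ y)) * Real.exp (t * (G₁ y - m)) := by
            intro x
            rw [← Real.exp_add]
            congr 1
            ring
          simp_rw [this]
          rw [integral_mul_const]
          refine mul_le_mul_of_nonneg_right ?_ (Real.exp_pos _).le
          exact ih (fun x => H (y, x)) (hH.comp measurable_prodMk_left) ⟨B, fun x => hHB _⟩
            fun x x' => by simpa [hd] using hHL y y x x'
      _ = c ^ N * ∫ y, Real.exp (t * (G₁ y - m)) ∂μ := integral_const_mul _ _
      _ ≤ c ^ N * c := by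
          refine mul_le_mul_of_nonneg_left ?_ (pow_nonneg hc0 N)
          rw [hmG₁]
          exact h1 G₁ hG₁ ⟨B, hG₁B⟩ hG₁L
      _ = c ^ (N + 1) := (pow_succ c N).symm

/-- Chernoff's bound for functions that are `1/N`-Lipschitz in each of the `N` coordinates. -/
theorem measureReal_le_exp_of_lipschitz (μ : Measure E) [IsProbabilityMeasure μ] (d : E → E → ℝ)
    (hd : ∀ y, d y y = 0) {t ψ : ℝ} (ht : 0 ≤ t)
    (h1 : ∀ h : E → ℝ, Measurable h → (∃ B, ∀ y, |h y| ≤ B) → (∀ y z, |h y - h z| ≤ d y z) →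
      ∫ y, Real.exp (t * (h y - ∫ z, h z ∂μ)) ∂μ ≤ Real.exp ψ)
    {N : ℕ} (hN : 1 ≤ N) (G : (Fin N → E) → ℝ) (hG : Measurable G) (hB : ∃ B, ∀ x, |G x| ≤ B)
    (hL : ∀ x y, |G x - G y| ≤ ∑ j, (N : ℝ)⁻¹ * d (x j) (y j)) (δ : ℝ) :
    (Measure.pi fun _ => μ).real {x | δ ≤ G x - ∫ y, G y ∂(Measure.pi fun _ => μ)} ≤
      Real.exp (-N * (t * δ - ψ)) := by
  have hN0 : (0 : ℝ) < N := by exact_mod_cast hN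
  obtain ⟨B, hB⟩ := hB
  let ρ : Measure (Fin N → E) := Measure.pi fun _ => μ
  have key := integral_exp_sub_integral_pi_le μ d hd t (Real.exp ψ) (Real.exp_pos ψ).le h1 N (fun x => N * G x)
    (hG.const_mul _) ⟨N * B, fun x => by
      rw [abs_mul, abs_of_pos hN0]; exact mul_le_mul_of_nonneg_left (hB x) hN0.le⟩
    (fun x y => by
      rw [← mul_sub, abs_mul, abs_of_pos hN0]
      refine (mul_le_mul_of_nonneg_left (hL x y) hN0.le).trans_eq ?_
      rw [← Finset.mul_sum, mul_inv_cancel_left₀ hN0.ne'])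
  rw [integral_const_mul] at key
  set m := ∫ y, G y ∂(Measure.pi fun _ => μ) with hm
  have hexpi : Integrable (fun x => Real.exp (t * (N * G x - N * m))) ρ := by
    refine Integrable.of_bound (C := Real.exp (|t| * (N * B + |N * m|))) ?_ ?_
    · exact ((((hG.const_mul _).sub_const _).const_mul t).exp).aestronglyMeasurable
    · refine Filter.Eventually.of_forall fun z => ?_
      rw [Real.norm_of_nonneg (Real.exp_pos _).le]
      refine Real.exp_le_exp.2 ((le_abs_self _).trans ?_)
      rw [abs_mul]
      refine mul_le_mul_of_nonneg_left ((abs_sub _ _).trans ?_) (abs_nonneg t)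
      rw [abs_mul, abs_of_pos hN0]
      linarith [mul_le_mul_of_nonneg_left (hB z) hN0.le]
  have := measure_ge_le_exp_mul_mgf (μ := ρ) (X := fun x => N * G x - N * m) (N * δ) ht hexpi
  have hset : {x | δ ≤ G x - m} = {x | N * δ ≤ N * G x - N * m} := by
    ext x
    simp only [Set.mem_ofPred_eq]
    rw [← mul_sub, mul_le_mul_iff_right₀ hN0]
  rw [hset]
  refine this.trans ((mul_le_mul_of_nonneg_left key (Real.exp_pos _).le).trans_eq ?_)
  rw [← Real.exp_nat_mul, ← Real.exp_add]
  congr 1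
  ring

end Tensorization

section ExponentialMoment

/-- A crude form of Young's inequality. -/
lemma mul_le_rpow_add_rpow {a : ℝ} (ha : 1 < a) {t r : ℝ} (ht : 0 ≤ t) (hr : 0 ≤ r) :
    t * r ≤ r ^ a + t ^ (1 + (a - 1)⁻¹) := by
  have ha' : 0 < a - 1 := by linarith
  rcases ht.eq_or_lt with rfl | ht0
  · rw [zero_mul]; positivity
  rcases hr.eq_or_lt with rfl | hr0
  · rw [mul_zero]; positivity
  rcases le_total (t ^ (a - 1)⁻¹) r with h | h
  · have h1 : t ≤ r ^ (a - 1) := by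
      have := Real.rpow_le_rpow (by positivity) h ha'.le
      rwa [← Real.rpow_mul ht, inv_mul_cancel₀ ha'.ne', Real.rpow_one] at this
    have h2 : r ^ (a - 1) * r = r ^ a := by
      rw [← Real.rpow_add_one hr0.ne']; congr 1; ring
    have h3 := mul_le_mul_of_nonneg_right h1 hr
    have h4 : 0 ≤ t ^ (1 + (a - 1)⁻¹) := by positivity
    linarith
  · have h2 : t * t ^ (a - 1)⁻¹ = t ^ (1 + (a - 1)⁻¹) := by
      rw [Real.rpow_add ht0, Real.rpow_one]
    have h3 := mul_le_mul_of_nonneg_left h ht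
    have h4 : 0 ≤ r ^ a := by positivity
    linarith

lemma exp_le_one_add_add_sq_mul_exp_abs (u : ℝ) :
    Real.exp u ≤ 1 + u + u ^ 2 * Real.exp |u| := by
  have he : 1 ≤ Real.exp |u| := Real.one_le_exp (abs_nonneg u)
  by_cases h : |u| ≤ 1
  · have h1 := (abs_le.1 (Real.abs_exp_sub_one_sub_id_le h)).2
    nlinarith [sq_nonneg u]
  · rcases le_total 0 u with h0 | h0
    · rw [abs_of_nonneg h0] at h ⊢
      nlinarith [Real.exp_pos u, mul_pos (show 0 < u ^ 2 - 1 by nlinarith) (Real.exp_pos u)]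
    · rw [abs_of_nonpos h0] at h he ⊢
      have : Real.exp u ≤ 1 := Real.exp_le_one_iff.2 h0
      nlinarith [sq_nonneg u]

variable {n : ℕ} {a : ℝ} {μ : Measure (Fin n → ℝ)}

lemma le_exp_rpow (ha : 1 < a) {r : ℝ} (hr : 0 ≤ r) : r ≤ Real.exp (r ^ a) := by
  rcases le_total r 1 with h | h
  · exact h.trans (Real.one_le_exp (by positivity))
  · have := Real.self_le_rpow_of_one_le h ha.le
    linarith [Real.add_one_le_exp (r ^ a)]

lemma one_le_expMoment [IsProbabilityMeasure μ] (hi : Integrable (fun x => Real.exp (l1norm x ^ a)) μ) :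
    1 ≤ expMoment a μ := by
  have := integral_mono (integrable_const (1 : ℝ)) hi fun x =>
    Real.one_le_exp (Real.rpow_nonneg (l1norm_nonneg x) a)
  simpa [expMoment] using this

lemma integrable_l1norm_of_expMoment (ha : 1 < a)
    (hi : Integrable (fun x => Real.exp (l1norm x ^ a)) μ) : Integrable l1norm μ :=
  hi.mono' continuous_l1norm.aestronglyMeasurable (Filter.Eventually.of_forall fun x => by
    rw [Real.norm_of_nonneg (l1norm_nonneg x)]
    exact le_exp_rpow ha (l1norm_nonneg x))

lemma integral_l1norm_le (ha : 1 < a)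
    (hi : Integrable (fun x => Real.exp (l1norm x ^ a)) μ) :
    ∫ x, l1norm x ∂μ ≤ expMoment a μ :=
  integral_mono (integrable_l1norm_of_expMoment ha hi) hi fun x => le_exp_rpow ha (l1norm_nonneg x)

lemma exp_mul_l1norm_le (ha : 1 < a) {t : ℝ} (ht : 0 ≤ t) (x : Fin n → ℝ) :
    Real.exp (t * l1norm x) ≤ Real.exp (t ^ (1 + (a - 1)⁻¹)) * Real.exp (l1norm x ^ a) := by
  rw [← Real.exp_add, add_comm]
  exact Real.exp_le_exp.2 (mul_le_rpow_add_rpow ha ht (l1norm_nonneg x))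

lemma integrable_exp_mul_l1norm (ha : 1 < a)
    (hi : Integrable (fun x => Real.exp (l1norm x ^ a)) μ) {t : ℝ} (ht : 0 ≤ t) :
    Integrable (fun x => Real.exp (t * l1norm x)) μ :=
  (hi.const_mul _).mono'
    (Real.continuous_exp.comp (continuous_l1norm.const_mul t)).aestronglyMeasurable
    (Filter.Eventually.of_forall fun x => by
      rw [Real.norm_of_nonneg (Real.exp_pos _).le]
      exact exp_mul_l1norm_le ha ht x)

lemma integral_exp_mul_l1norm_le (ha : 1 < a)
    (hi : Integrable (fun x => Real.exp (l1norm x ^ a)) μ) {t : ℝ} (ht : 0 ≤ t) :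
    ∫ x, Real.exp (t * l1norm x) ∂μ ≤ Real.exp (t ^ (1 + (a - 1)⁻¹)) * expMoment a μ := by
  rw [expMoment, ← integral_const_mul]
  exact integral_mono (integrable_exp_mul_l1norm ha hi ht) (hi.const_mul _)
    fun x => exp_mul_l1norm_le ha ht x

/-- The constant in the bounds of the Laplace transform of Lipschitz functions. -/
noncomputable def laplaceConst (a A : ℝ) : ℝ :=
  2 * (Real.exp (2 * A) * (Real.exp (2 ^ (1 + (a - 1)⁻¹)) * A)) + (2 * A + 1)

lemma one_le_laplaceConst {A : ℝ} (hA : 1 ≤ A) : 1 ≤ laplaceConst a A := by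
  have : 0 ≤ 2 * (Real.exp (2 * A) * (Real.exp (2 ^ (1 + (a - 1)⁻¹)) * A)) := by positivity
  rw [laplaceConst]
  linarith

variable {h : (Fin n → ℝ) → ℝ}

lemma abs_sub_integral_le [IsProbabilityMeasure μ] (hl : Integrable l1norm μ) (hh : Integrable h μ)
    (hL : ∀ y z, |h y - h z| ≤ l1norm (y - z)) (y : Fin n → ℝ) :
    |h y - ∫ z, h z ∂μ| ≤ l1norm y + ∫ z, l1norm z ∂μ := by
  have e1 : h y - ∫ z, h z ∂μ = ∫ z, (h y - h z) ∂μ := by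
    rw [integral_sub (integrable_const _) hh]; simp
  have e2 : l1norm y + ∫ z, l1norm z ∂μ = ∫ z, (l1norm y + l1norm z) ∂μ := by
    rw [integral_add (integrable_const _) hl]; simp
  rw [e1, e2]
  refine (abs_integral_le_integral_abs).trans
    (integral_mono ((integrable_const _).sub hh).abs ((integrable_const _).add hl) fun z => ?_)
  exact (hL y z).trans (l1norm_sub_le y z)

theorem integral_exp_le_of_le_one [IsProbabilityMeasure μ] (ha : 1 < a)
    (hi : Integrable (fun x => Real.exp (l1norm x ^ a)) μ) (hm : Measurable h)
    (hB : ∃ B, ∀ y, |h y| ≤ B) (hL : ∀ y z, |h y - h z| ≤ l1norm (y - z)) {t : ℝ} (ht : 0 ≤ t)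
    (ht1 : t ≤ 1) :
    ∫ y, Real.exp (t * (h y - ∫ z, h z ∂μ)) ∂μ ≤
      Real.exp (laplaceConst a (expMoment a μ) * t ^ 2) := by
  obtain ⟨B, hB⟩ := hB
  have hA := one_le_expMoment hi
  set A := expMoment a μ with hAdef
  have hl := integrable_l1norm_of_expMoment ha hi
  have hh : Integrable h μ := Integrable.of_bound hm.aestronglyMeasurable B
    (Filter.Eventually.of_forall fun z => by rw [Real.norm_eq_abs]; exact hB z)
  have hY := abs_sub_integral_le hl hh hL
  have hlA : ∫ z, l1norm z ∂μ ≤ A := integral_l1norm_le ha hi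
  set m := ∫ z, h z ∂μ with hmdef
  have hpt : ∀ y, Real.exp (t * (h y - m)) ≤ 1 + t * (h y - m) +
      t ^ 2 * (2 * (Real.exp (2 * A) * Real.exp (2 * l1norm y))) := by
    intro y
    have h1 := exp_le_one_add_add_sq_mul_exp_abs (t * (h y - m))
    have h2 : |h y - m| ≤ l1norm y + A := (hY y).trans (by linarith)
    set g := l1norm y + A with hg
    have hg0 : 0 ≤ g := (abs_nonneg _).trans h2
    have h3 : (h y - m) ^ 2 ≤ g ^ 2 := sq_le_sq' (by linarith [neg_abs_le (h y - m)])
      ((le_abs_self _).trans h2)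
    have h4 : g ^ 2 ≤ 2 * Real.exp g := by
      have := Real.quadratic_le_exp_of_nonneg hg0
      nlinarith
    have h5 : Real.exp |t * (h y - m)| ≤ Real.exp g := by
      refine Real.exp_le_exp.2 ?_
      rw [abs_mul, abs_of_nonneg ht]
      nlinarith [abs_nonneg (h y - m)]
    have h6 : (t * (h y - m)) ^ 2 * Real.exp |t * (h y - m)| ≤
        t ^ 2 * (2 * Real.exp g) * Real.exp g := by
      rw [mul_pow]
      refine mul_le_mul (mul_le_mul_of_nonneg_left (h3.trans h4) (sq_nonneg t)) h5
        (Real.exp_pos _).le (by positivity)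
    have h7 : Real.exp g * Real.exp g = Real.exp (2 * A) * Real.exp (2 * l1norm y) := by
      rw [← Real.exp_add, ← Real.exp_add, hg]; congr 1; ring
    rw [← h7]
    linarith
  have hYi : Integrable (fun y => t * (h y - m)) μ := (hh.sub (integrable_const m)).const_mul t
  have he2 := integrable_exp_mul_l1norm ha hi (show (0 : ℝ) ≤ 2 by norm_num)
  have hexpi : Integrable (fun y => Real.exp (t * (h y - m))) μ := by
    refine Integrable.of_bound (C := Real.exp (|t| * (B + |m|)))
      (((hm.sub_const m).const_mul t).exp).aestronglyMeasurable
      (Filter.Eventually.of_forall fun z => ?_)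
    rw [Real.norm_of_nonneg (Real.exp_pos _).le]
    refine Real.exp_le_exp.2 ((le_abs_self _).trans ?_)
    rw [abs_mul]
    exact mul_le_mul_of_nonneg_left ((abs_sub _ _).trans (by linarith [hB z])) (abs_nonneg t)
  have hE : ∫ y, Real.exp (2 * l1norm y) ∂μ ≤ Real.exp (2 ^ (1 + (a - 1)⁻¹)) * A :=
    integral_exp_mul_l1norm_le ha hi (by norm_num)
  have hmean : ∫ y, t * (h y - m) ∂μ = 0 := by
    rw [integral_const_mul, integral_sub hh (integrable_const m)]
    simp [← hmdef]
  calc ∫ y, Real.exp (t * (h y - m)) ∂μ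
      ≤ ∫ y, (1 + t * (h y - m) +
          t ^ 2 * (2 * (Real.exp (2 * A) * Real.exp (2 * l1norm y)))) ∂μ :=
        integral_mono hexpi (((integrable_const 1).add hYi).add
          (((he2.const_mul _).const_mul _).const_mul _)) hpt
    _ = 1 + t ^ 2 * (2 * (Real.exp (2 * A) * ∫ y, Real.exp (2 * l1norm y) ∂μ)) := by
        have hYi1 : Integrable (fun y => 1 + t * (h y - m)) μ := (integrable_const 1).add hYi
        rw [integral_add hYi1
          (((he2.const_mul _).const_mul _).const_mul _), integral_add (integrable_const 1) hYi,
          hmean, integral_const_mul, integral_const_mul, integral_const_mul]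
        simp
    _ ≤ 1 + laplaceConst a A * t ^ 2 := by
        have h1 := mul_le_mul_of_nonneg_left hE (Real.exp_pos (2 * A)).le
        have h2 : 2 * (Real.exp (2 * A) * ∫ y, Real.exp (2 * l1norm y) ∂μ) ≤
            laplaceConst a A := by
          rw [laplaceConst]; linarith
        have := mul_le_mul_of_nonneg_left h2 (sq_nonneg t)
        linarith
    _ ≤ _ := by
        rw [add_comm]
        exact Real.add_one_le_exp _

theorem integral_exp_le_of_one_le [IsProbabilityMeasure μ] (ha : 1 < a)
    (hi : Integrable (fun x => Real.exp (l1norm x ^ a)) μ) (hm : Measurable h)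
    (hB : ∃ B, ∀ y, |h y| ≤ B) (hL : ∀ y z, |h y - h z| ≤ l1norm (y - z)) {t : ℝ}
    (ht1 : 1 ≤ t) :
    ∫ y, Real.exp (t * (h y - ∫ z, h z ∂μ)) ∂μ ≤
      Real.exp (laplaceConst a (expMoment a μ) * t ^ (1 + (a - 1)⁻¹)) := by
  obtain ⟨B, hB⟩ := hB
  have hA := one_le_expMoment hi
  have ht : 0 ≤ t := by linarith
  set A := expMoment a μ with hAdef
  have hl := integrable_l1norm_of_expMoment ha hi
  have hh : Integrable h μ := Integrable.of_bound hm.aestronglyMeasurable B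
    (Filter.Eventually.of_forall fun z => by rw [Real.norm_eq_abs]; exact hB z)
  have hY := abs_sub_integral_le hl hh hL
  have hlA : ∫ z, l1norm z ∂μ ≤ A := integral_l1norm_le ha hi
  set m := ∫ z, h z ∂μ with hmdef
  have he2 := integrable_exp_mul_l1norm ha hi ht
  have hexpi : Integrable (fun y => Real.exp (t * (h y - m))) μ := by
    refine Integrable.of_bound (C := Real.exp (|t| * (B + |m|)))
      (((hm.sub_const m).const_mul t).exp).aestronglyMeasurable
      (Filter.Eventually.of_forall fun z => ?_)
    rw [Real.norm_of_nonneg (Real.exp_pos _).le]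
    refine Real.exp_le_exp.2 ((le_abs_self _).trans ?_)
    rw [abs_mul]
    exact mul_le_mul_of_nonneg_left ((abs_sub _ _).trans (by linarith [hB z])) (abs_nonneg t)
  set b := 1 + (a - 1)⁻¹ with hb
  have hb1 : 1 ≤ b := by
    have : 0 < (a - 1)⁻¹ := inv_pos.2 (by linarith)
    linarith
  calc ∫ y, Real.exp (t * (h y - m)) ∂μ
      ≤ ∫ y, Real.exp (t * A) * Real.exp (t * l1norm y) ∂μ := by
        refine integral_mono hexpi (he2.const_mul _) fun y => ?_
        dsimp only
        rw [← Real.exp_add, ← mul_add]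
        refine Real.exp_le_exp.2 (mul_le_mul_of_nonneg_left ?_ ht)
        linarith [hY y, le_abs_self (h y - m)]
    _ ≤ Real.exp (t * A) * (Real.exp (t ^ b) * A) := by
        rw [integral_const_mul]
        exact mul_le_mul_of_nonneg_left (integral_exp_mul_l1norm_le ha hi ht) (Real.exp_pos _).le
    _ ≤ Real.exp (t * A) * (Real.exp (t ^ b) * Real.exp A) := by
        gcongr
        linarith [Real.add_one_le_exp A]
    _ = Real.exp (t * A + (t ^ b + A)) := by rw [Real.exp_add, Real.exp_add]
    _ ≤ _ := by
        refine Real.exp_le_exp.2 ?_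
        have h1 : t ≤ t ^ b := Real.self_le_rpow_of_one_le ht1 hb1
        have h2 : 1 ≤ t ^ b := ht1.trans h1
        have h3 : 2 * A + 1 ≤ laplaceConst a A := by
          have : 0 ≤ 2 * (Real.exp (2 * A) * (Real.exp (2 ^ (1 + (a - 1)⁻¹)) * A)) := by
            positivity
          rw [laplaceConst]; linarith
        have h4 := mul_le_mul_of_nonneg_right h3 (show 0 ≤ t ^ b by linarith)
        nlinarith

end ExponentialMoment

section Frequency

variable {E : Type*} [MeasurableSpace E] {N : ℕ}

open Classical in
/-- The mean deviation of an empirical frequency is at most its standard deviation. -/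
lemma integrable_and_integral_abs_frequency_le (μ : Measure E) [IsProbabilityMeasure μ]
    (hN : 1 ≤ N) {Q : Set E} (hQ : MeasurableSet Q) :
    Integrable (fun x : Fin N → E => |μ.real Q - ∑ j with x j ∈ Q, (N : ℝ)⁻¹|)
        (Measure.pi fun _ => μ) ∧
      ∫ x : Fin N → E, |μ.real Q - ∑ j with x j ∈ Q, (N : ℝ)⁻¹| ∂(Measure.pi fun _ => μ) ≤
        √(μ.real Q / N) := by
  have hN0 : (0 : ℝ) < N := by exact_mod_cast hN
  let ρ : Measure (Fin N → E) := Measure.pi fun _ => μ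
  let φ : E → ℝ := Q.indicator fun _ => (N : ℝ)⁻¹
  have hφ : MemLp φ 2 μ := memLp_indicator_const 2 hQ _ (Or.inr (measure_ne_top _ _))
  let Z : (Fin N → E) → ℝ := ∑ j, fun x => φ (x j)
  have hZsum : ∀ x : Fin N → E, ∑ j with x j ∈ Q, (N : ℝ)⁻¹ = Z x := by
    intro x
    simp only [Z, Finset.sum_apply, φ, Set.indicator_apply]
    rw [Finset.sum_filter]
  have hφj : ∀ j : Fin N, MemLp (fun x : Fin N → E => φ (x j)) 2 ρ := fun j =>
    hφ.comp_measurePreserving (measurePreserving_eval (fun _ => μ) j)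
  have hZ : MemLp Z 2 ρ := memLp_finsetSum' _ fun j _ => hφj j
  have hφint : ∀ j : Fin N, ∫ x : Fin N → E, φ (x j) ∂ρ = (N : ℝ)⁻¹ * μ.real Q := by
    intro j
    have := integral_map (μ := ρ) (φ := fun x : Fin N → E => x j) (f := φ)
      (measurable_pi_apply j).aemeasurable
    rw [(measurePreserving_eval (fun _ : Fin N => μ) j).map_eq] at this
    rw [← this hφ.aestronglyMeasurable, integral_indicator hQ, setIntegral_const, smul_eq_mul,
      mul_comm]
  have hmean : ∫ x, Z x ∂ρ = μ.real Q := by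
    simp only [Z, Finset.sum_apply]
    rw [integral_finsetSum _ fun j _ => (hφj j).integrable (by norm_num)]
    simp_rw [hφint]
    rw [Finset.sum_const, Finset.card_univ, Fintype.card_fin, nsmul_eq_mul,
      mul_inv_cancel_left₀ hN0.ne']
  have hvarφ : variance φ μ ≤ (N : ℝ)⁻¹ ^ 2 * μ.real Q := by
    refine (variance_le_expectation_sq hφ.aestronglyMeasurable).trans_eq ?_
    have : φ ^ 2 = Q.indicator fun _ => (N : ℝ)⁻¹ ^ 2 := by
      funext y
      by_cases hy : y ∈ Q <;> simp [φ, hy]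
    rw [this, integral_indicator hQ, setIntegral_const, smul_eq_mul, mul_comm]
  have hvar : variance Z ρ ≤ μ.real Q / N := by
    have := variance_sum_pi (μ := fun _ : Fin N => μ) (X := fun _ => φ) fun _ => hφ
    rw [show variance Z ρ = _ from this, Finset.sum_const, Finset.card_univ, Fintype.card_fin,
      nsmul_eq_mul]
    refine (mul_le_mul_of_nonneg_left hvarφ hN0.le).trans_eq ?_
    field_simp
  have hY : MemLp (fun x => |μ.real Q - Z x|) 2 ρ := ((memLp_const (μ.real Q)).sub hZ).abs
  simp_rw [hZsum]
  refine ⟨hY.integrable (by norm_num), ?_⟩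
  refine Real.le_sqrt_of_sq_le (le_trans ?_ hvar)
  have h1 := variance_nonneg (fun x => |μ.real Q - Z x|) ρ
  rw [variance_eq_sub hY] at h1
  rw [variance_eq_integral hZ.aestronglyMeasurable.aemeasurable, hmean]
  have h2 : ∫ x, ((fun x => |μ.real Q - Z x|) ^ 2) x ∂ρ = ∫ x, (Z x - μ.real Q) ^ 2 ∂ρ := by
    refine integral_congr_ae (Filter.Eventually.of_forall fun x => ?_)
    simp only [Pi.pow_apply, sq_abs]
    ring
  rw [h2] at h1
  linarith

end Frequency

section DyadicSums

lemma sum_Ico_neg_eq (g : ℤ → ℝ) (K : ℕ) :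
    ∑ k ∈ Finset.Ico (-(K : ℤ)) K, g k =
      ∑ k ∈ Finset.range K, (g k + g (-((k : ℤ) + 1))) := by
  induction K with
  | zero => simp
  | succ K ih =>
    have : Finset.Ico (-((K + 1 : ℕ) : ℤ)) ((K + 1 : ℕ) : ℤ) =
        insert (K : ℤ) (insert (-((K : ℤ) + 1)) (Finset.Ico (-(K : ℤ)) K)) := by
      ext k
      simp only [Finset.mem_Ico, Finset.mem_insert]
      omega
    rw [this, Finset.sum_insert, Finset.sum_insert, ih, Finset.sum_range_succ]
    · ring
    · simp
    · simp only [Finset.mem_Ico, Finset.mem_insert]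
      omega

lemma sum_exp_neg_abs_le {m : ℝ} (hm : 1 ≤ m) (K : ℕ) :
    ∑ k ∈ Finset.Ico (-(K : ℤ)) K, Real.exp (-(|(k : ℝ)| / m)) ≤ 4 * m := by
  have hm0 : 0 < m := by linarith
  set r := Real.exp (-(1 / m)) with hr
  have hr0 : 0 < r := Real.exp_pos _
  have hr1 : r < 1 := Real.exp_lt_one_iff.2 (by rw [neg_lt_zero]; positivity)
  have hpow : ∀ k : ℕ, Real.exp (-((k : ℝ) / m)) = r ^ k := by
    intro k
    rw [hr, ← Real.exp_nat_mul]
    congr 1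
    ring
  have hgeom : ∑ k ∈ Finset.range K, r ^ k ≤ 2 * m := by
    have h1 : ∑ k ∈ Finset.range K, r ^ k ≤ (1 - r)⁻¹ := by
      rw [← tsum_geometric_of_lt_one hr0.le hr1]
      exact (summable_geometric_of_lt_one hr0.le hr1).sum_le_tsum _ fun _ _ => by positivity
    refine h1.trans ?_
    have h2 : r * (1 + 1 / m) ≤ 1 := by
      have h3 := Real.add_one_le_exp (1 / m)
      have h4 : r * Real.exp (1 / m) = 1 := by rw [hr, ← Real.exp_add]; simp
      have := mul_le_mul_of_nonneg_left h3 hr0.le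
      linarith
    have h5 : r * (m + 1) ≤ m := by
      have := mul_le_mul_of_nonneg_right h2 hm0.le
      have h6 : r * (1 + 1 / m) * m = r * (m + 1) := by field_simp
      linarith
    rw [inv_le_comm₀ (by linarith) (by linarith)]
    have h7 : r ≤ m / (m + 1) := by rwa [le_div_iff₀ (by linarith)]
    have h8 : m / (m + 1) = 1 - 1 / (m + 1) := by field_simp; ring
    have h9 : (2 * m)⁻¹ ≤ 1 / (m + 1) := by
      rw [← one_div]
      exact one_div_le_one_div_of_le (by linarith) (by linarith)
    linarith
  rw [sum_Ico_neg_eq]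
  calc ∑ k ∈ Finset.range K, (Real.exp (-(|((k : ℤ) : ℝ)| / m)) +
        Real.exp (-(|((-((k : ℤ) + 1) : ℤ) : ℝ)| / m)))
      ≤ ∑ k ∈ Finset.range K, (r ^ k + r ^ k) := by
        refine Finset.sum_le_sum fun k _ => ?_
        have e1 : |((k : ℤ) : ℝ)| = k := by simp
        have e2 : |((-((k : ℤ) + 1) : ℤ) : ℝ)| = ((k + 1 : ℕ) : ℝ) := by
          push_cast
          rw [abs_neg, abs_of_nonneg (by positivity)]
        rw [e1, e2, hpow, hpow]
        have : r ^ (k + 1) ≤ r ^ k := pow_le_pow_of_le_one hr0.le hr1.le (Nat.le_succ k)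
        linarith
    _ ≤ 4 * m := by
        rw [Finset.sum_add_distrib]
        linarith

variable {n : ℕ}

/-- The `ℓ₁`-norm of the corner of a dyadic cube. -/
noncomputable def cornerNorm (l : ℕ) (t : Fin n → ℤ) : ℝ := ∑ i, |(t i : ℝ)| / 2 ^ l

lemma cornerNorm_nonneg (l : ℕ) (t : Fin n → ℤ) : 0 ≤ cornerNorm l t :=
  Finset.sum_nonneg fun _ _ => by positivity

lemma cornerNorm_dyadicLabel_le (l : ℕ) (x : Fin n → ℝ) :
    cornerNorm l (dyadicLabel l x) ≤ l1norm x + n := by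
  have : cornerNorm l (dyadicLabel l x) ≤ ∑ i, (|x i| + 1) := by
    refine Finset.sum_le_sum fun i _ => ?_
    have h2 : (1 : ℝ) ≤ 2 ^ l := one_le_pow₀ (by norm_num)
    rw [div_le_iff₀ (by linarith), dyadicLabel]
    have h3 := Int.floor_le (2 ^ l * x i)
    have h4 := Int.lt_floor_add_one (2 ^ l * x i)
    have h5 : |(⌊2 ^ l * x i⌋ : ℝ) - 2 ^ l * x i| ≤ 1 := by
      rw [abs_le]; constructor <;> linarith
    have h6 : |(⌊2 ^ l * x i⌋ : ℝ)| ≤ |2 ^ l * x i| + 1 := by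
      calc |(⌊2 ^ l * x i⌋ : ℝ)| = |2 ^ l * x i + (⌊2 ^ l * x i⌋ - 2 ^ l * x i)| := by ring_nf
        _ ≤ _ := (abs_add_le _ _).trans (by linarith)
    rw [abs_mul, abs_of_pos (by linarith : (0 : ℝ) < 2 ^ l)] at h6
    linarith
  refine this.trans_eq ?_
  rw [Finset.sum_add_distrib]
  simp [l1norm]

lemma sum_exp_neg_cornerNorm_le (M l : ℕ) :
    ∑ t ∈ dyadicBox n M l, Real.exp (-cornerNorm l t) ≤ (4 * 2 ^ l) ^ n := by
  have h1 : ∀ t : Fin n → ℤ, Real.exp (-cornerNorm l t) =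
      ∏ i, Real.exp (-(|(t i : ℝ)| / 2 ^ l)) := by
    intro t
    rw [← Real.exp_sum, cornerNorm, Finset.sum_neg_distrib]
  simp_rw [h1]
  rw [dyadicBox, Finset.sum_prod_piFinset _ fun (_ : Fin n) (k : ℤ) =>
    Real.exp (-(|(k : ℝ)| / 2 ^ l)), Finset.prod_const, Finset.card_univ, Fintype.card_fin]
  refine pow_le_pow_left₀ (Finset.sum_nonneg fun _ _ => (Real.exp_pos _).le) ?_ n
  have := sum_exp_neg_abs_le (m := 2 ^ l) (one_le_pow₀ (by norm_num)) (M * 2 ^ l)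
  push_cast at this
  exact this

/-- The constant in the bound of the weighted sum of standard deviations. -/
noncomputable def deviationConst (n : ℕ) (a A : ℝ) : ℝ :=
  √(Real.exp (3 * n) * (Real.exp (3 ^ (1 + (a - 1)⁻¹)) * A) * 4 ^ n)

lemma sum_exp_cornerNorm_mul_sqrt_le {a : ℝ} (ha : 1 < a) {μ : Measure (Fin n → ℝ)}
    [IsProbabilityMeasure μ] (hi : Integrable (fun x => Real.exp (l1norm x ^ a)) μ) (M l : ℕ) :
    ∑ t ∈ dyadicBox n M l, Real.exp (cornerNorm l t) * √(μ.real (dyadicLabel l ⁻¹' {t})) ≤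
      deviationConst n a (expMoment a μ) * √((2 ^ n) ^ l) := by
  have hQ : ∀ t : Fin n → ℤ, MeasurableSet (dyadicLabel l ⁻¹' {t} : Set (Fin n → ℝ)) := fun t =>
    measurable_dyadicLabel l (measurableSet_singleton _)
  have he3 := (integrable_exp_mul_l1norm ha hi (show (0 : ℝ) ≤ 3 by norm_num)).const_mul
    (Real.exp (3 * n))
  have hmom : ∑ t ∈ dyadicBox n M l,
      μ.real (dyadicLabel l ⁻¹' {t}) * Real.exp (3 * cornerNorm l t) ≤
        Real.exp (3 * n) * (Real.exp (3 ^ (1 + (a - 1)⁻¹)) * expMoment a μ) := by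
    calc ∑ t ∈ dyadicBox n M l, μ.real (dyadicLabel l ⁻¹' {t}) * Real.exp (3 * cornerNorm l t)
        ≤ ∑ t ∈ dyadicBox n M l, ∫ x in dyadicLabel l ⁻¹' {t},
            Real.exp (3 * n) * Real.exp (3 * l1norm x) ∂μ := by
          refine Finset.sum_le_sum fun t _ => ?_
          rw [← smul_eq_mul, ← setIntegral_const]
          refine setIntegral_mono_on (integrable_const _) he3.integrableOn (hQ t) fun x hx => ?_
          rw [← Real.exp_add]
          refine Real.exp_le_exp.2 ?_
          have := cornerNorm_dyadicLabel_le l x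
          rw [show dyadicLabel l x = t from hx] at this
          linarith
      _ = ∫ x in ⋃ t ∈ dyadicBox n M l, dyadicLabel l ⁻¹' {t},
            Real.exp (3 * n) * Real.exp (3 * l1norm x) ∂μ := by
          rw [integral_biUnion_finset _ (fun t _ => hQ t) _ fun t _ => he3.integrableOn]
          intro t _ t' _ htt'
          exact Set.disjoint_left.2 fun x h1 h2 => htt' (h1.symm.trans h2)
      _ ≤ ∫ x, Real.exp (3 * n) * Real.exp (3 * l1norm x) ∂μ :=
          setIntegral_le_integral he3 (Filter.Eventually.of_forall fun x => by positivity)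
      _ ≤ _ := by
          rw [integral_const_mul]
          exact mul_le_mul_of_nonneg_left (integral_exp_mul_l1norm_le ha hi (by norm_num))
            (Real.exp_pos _).le
  have hsplit : ∀ t ∈ dyadicBox n M l,
      Real.exp (cornerNorm l t) * √(μ.real (dyadicLabel l ⁻¹' {t})) =
        √(μ.real (dyadicLabel l ⁻¹' {t}) * Real.exp (3 * cornerNorm l t)) *
          √(Real.exp (-cornerNorm l t)) := by
    intro t _
    rw [← Real.sqrt_mul (by positivity), mul_assoc, ← Real.exp_add,
      show 3 * cornerNorm l t + -cornerNorm l t = cornerNorm l t + cornerNorm l t by ring,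
      Real.exp_add, Real.sqrt_mul measureReal_nonneg, Real.sqrt_mul_self (Real.exp_pos _).le,
      mul_comm]
  rw [Finset.sum_congr rfl hsplit]
  refine (Real.sum_sqrt_mul_sqrt_le _ (fun t => by positivity) (fun t => by positivity)).trans ?_
  rw [deviationConst, ← Real.sqrt_mul (Finset.sum_nonneg fun _ _ => by positivity),
    ← Real.sqrt_mul' _ (by positivity)]
  refine Real.sqrt_le_sqrt ?_
  refine (mul_le_mul hmom (sum_exp_neg_cornerNorm_le M l)
    (Finset.sum_nonneg fun _ _ => (Real.exp_pos _).le) (by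
      have : 0 ≤ expMoment a μ := integral_nonneg fun _ => (Real.exp_pos _).le
      positivity)).trans_eq ?_
  rw [mul_pow, mul_assoc _ (4 ^ n), ← pow_mul, ← pow_mul, mul_comm l n]

lemma cubeNorm_le (t : Fin n → ℤ) : cubeNorm t ≤ Real.exp n * Real.exp (cornerNorm 0 t) := by
  have : cubeNorm t = cornerNorm 0 t + n := by
    rw [cubeNorm, cornerNorm, Finset.sum_add_distrib]
    simp
  rw [this, ← Real.exp_add]
  linarith [Real.add_one_le_exp (n + cornerNorm 0 t)]

end DyadicSums

section Mean

variable {n N : ℕ} {μ : Measure (Fin n → ℝ)} [IsProbabilityMeasure μ]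

lemma integrable_dyadicDiscrepancy (hN : 1 ≤ N) (l : ℕ) (t : Fin n → ℤ) :
    Integrable (fun x : Fin N → (Fin n → ℝ) => dyadicDiscrepancy μ x l t)
      (Measure.pi fun _ => μ) := by
  convert (integrable_and_integral_abs_frequency_le μ hN
    (measurable_dyadicLabel l (measurableSet_singleton t))).1 using 3
  simp only [dyadicDiscrepancy, Set.mem_preimage, Set.mem_singleton_iff]

lemma integral_dyadicDiscrepancy_le (hN : 1 ≤ N) (l : ℕ) (t : Fin n → ℤ) :
    ∫ x : Fin N → (Fin n → ℝ), dyadicDiscrepancy μ x l t ∂(Measure.pi fun _ => μ) ≤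
      √(μ.real (dyadicLabel l ⁻¹' {t})) * (√N)⁻¹ := by
  rw [← div_eq_mul_inv, ← Real.sqrt_div measureReal_nonneg]
  convert (integrable_and_integral_abs_frequency_le μ hN
    (measurable_dyadicLabel l (measurableSet_singleton t))).2 using 4
  simp only [dyadicDiscrepancy, Set.mem_preimage, Set.mem_singleton_iff]

lemma sum_mul_integral_dyadicDiscrepancy_le {a : ℝ} (ha : 1 < a)
    (hi : Integrable (fun x => Real.exp (l1norm x ^ a)) μ) (hN : 1 ≤ N) (M l : ℕ) :
    ∑ t ∈ dyadicBox n M l, Real.exp (cornerNorm l t) *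
      ∫ x : Fin N → (Fin n → ℝ), dyadicDiscrepancy μ x l t ∂(Measure.pi fun _ => μ) ≤
        deviationConst n a (expMoment a μ) * √((2 ^ n) ^ l) * (√N)⁻¹ := by
  refine le_trans ?_ (mul_le_mul_of_nonneg_right (sum_exp_cornerNorm_mul_sqrt_le ha hi M l)
    (by positivity))
  rw [Finset.sum_mul]
  refine Finset.sum_le_sum fun t _ => ?_
  rw [mul_assoc]
  exact mul_le_mul_of_nonneg_left (integral_dyadicDiscrepancy_le hN l t) (Real.exp_pos _).le

theorem integral_min_allocationCost_le_dyadic {a : ℝ} (ha : 1 < a)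
    (hi : Integrable (fun x => Real.exp (l1norm x ^ a)) μ) {M : ℕ}
    (hM : ∀ᵐ ξ ∂μ, ∀ i, -(M : ℝ) ≤ ξ i ∧ ξ i < (M : ℝ)) (hN : 1 ≤ N) {δ : ℝ} (hδ : 0 ≤ δ) (L : ℕ) :
    ∫ x : Fin N → (Fin n → ℝ), min (allocationCost μ x) δ ∂(Measure.pi fun _ => μ) ≤
      2 * (n / 2 ^ L) + deviationConst n a (expMoment a μ) * (√N)⁻¹ *
        (∑ l ∈ Finset.range L, n / 2 ^ l * √((2 ^ n) ^ (l + 1)) + Real.exp n) := by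
  have hl := integrable_l1norm_of_expMoment ha hi
  let ρ : Measure (Fin N → (Fin n → ℝ)) := Measure.pi fun _ => μ
  have hMx : ∀ᵐ x ∂ρ, ∀ j i, -(M : ℝ) ≤ x j i ∧ x j i < (M : ℝ) := by
    rw [ae_all_iff]
    intro j
    exact (measurePreserving_eval (fun _ : Fin N => μ) j).quasiMeasurePreserving.ae hM
  have hG0 : ∀ x : Fin N → (Fin n → ℝ), 0 ≤ min (allocationCost μ x) δ := fun x =>
    le_min (allocationCost_nonneg x) hδ
  have hGi : Integrable (fun x : Fin N → (Fin n → ℝ) => min (allocationCost μ x) δ) ρ :=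
    Integrable.of_bound
      ((continuous_allocationCost hN hl).measurable.min measurable_const).aestronglyMeasurable δ
      (Filter.Eventually.of_forall fun x => by
        rw [Real.norm_of_nonneg (hG0 x)]; exact min_le_right _ _)
  have hdi : ∀ l t, Integrable (fun x : Fin N → (Fin n → ℝ) => dyadicDiscrepancy μ x l t) ρ :=
    fun l t => integrable_dyadicDiscrepancy hN l t
  have hd0 : ∀ l t, 0 ≤ ∫ x : Fin N → (Fin n → ℝ), dyadicDiscrepancy μ x l t ∂ρ := fun l t =>
    integral_nonneg fun x => abs_nonneg _
  have hi1 : Integrable (fun x : Fin N → (Fin n → ℝ) => ∑ l ∈ Finset.range L, n / 2 ^ l *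
        ∑ t ∈ dyadicBox n M (l + 1), dyadicDiscrepancy μ x (l + 1) t) ρ :=
    integrable_finsetSum _ fun l _ => (integrable_finsetSum _ fun t _ => hdi _ t).const_mul _
  have hi2 : Integrable (fun x : Fin N → (Fin n → ℝ) =>
      ∑ t ∈ dyadicBox n M 0, cubeNorm t * dyadicDiscrepancy μ x 0 t) ρ :=
    integrable_finsetSum _ fun t _ => (hdi _ t).const_mul _
  have hi0 : Integrable (fun x : Fin N → (Fin n → ℝ) => 2 * ((n : ℝ) / 2 ^ L) +
      ∑ l ∈ Finset.range L, n / 2 ^ l *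
        ∑ t ∈ dyadicBox n M (l + 1), dyadicDiscrepancy μ x (l + 1) t) ρ :=
    (integrable_const _).add hi1
  have hA : ∀ l, ∫ x : Fin N → (Fin n → ℝ), ∑ t ∈ dyadicBox n M l, dyadicDiscrepancy μ x l t ∂ρ ≤
      deviationConst n a (expMoment a μ) * √((2 ^ n) ^ l) * (√N)⁻¹ := by
    intro l
    rw [integral_finsetSum _ fun t _ => hdi _ t]
    refine le_trans (Finset.sum_le_sum fun t _ => ?_)
      (sum_mul_integral_dyadicDiscrepancy_le ha hi hN M l)
    exact le_mul_of_one_le_left (hd0 l t) (Real.one_le_exp (cornerNorm_nonneg l t))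
  have hB : ∫ x : Fin N → (Fin n → ℝ), ∑ t ∈ dyadicBox n M 0,
      cubeNorm t * dyadicDiscrepancy μ x 0 t ∂ρ ≤
        Real.exp n * (deviationConst n a (expMoment a μ) * (√N)⁻¹) := by
    rw [integral_finsetSum _ fun t _ => (hdi _ t).const_mul _]
    have h0 := sum_mul_integral_dyadicDiscrepancy_le ha hi hN M 0
    rw [pow_zero, Real.sqrt_one, mul_one] at h0
    refine le_trans ?_ (mul_le_mul_of_nonneg_left h0 (Real.exp_pos _).le)
    rw [Finset.mul_sum]
    refine Finset.sum_le_sum fun t _ => ?_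
    rw [integral_const_mul, ← mul_assoc]
    exact mul_le_mul_of_nonneg_right (cubeNorm_le t) (hd0 0 t)
  calc ∫ x, min (allocationCost μ x) δ ∂ρ
      ≤ ∫ x : Fin N → (Fin n → ℝ), (2 * ((n : ℝ) / 2 ^ L) + ∑ l ∈ Finset.range L, n / 2 ^ l *
          ∑ t ∈ dyadicBox n M (l + 1), dyadicDiscrepancy μ x (l + 1) t +
          ∑ t ∈ dyadicBox n M 0, cubeNorm t * dyadicDiscrepancy μ x 0 t) ∂ρ := by
        refine integral_mono_ae hGi (hi0.add hi2) ?_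
        filter_upwards [hMx] with x hx
        exact (min_le_left _ _).trans (allocationCost_le_dyadic hN hM hl x hx L)
    _ = 2 * ((n : ℝ) / 2 ^ L) + ∑ l ∈ Finset.range L, n / 2 ^ l *
          ∫ x : Fin N → (Fin n → ℝ),
            ∑ t ∈ dyadicBox n M (l + 1), dyadicDiscrepancy μ x (l + 1) t ∂ρ +
          ∫ x : Fin N → (Fin n → ℝ), ∑ t ∈ dyadicBox n M 0,
            cubeNorm t * dyadicDiscrepancy μ x 0 t ∂ρ := by
        rw [integral_add hi0 hi2, integral_add (integrable_const _) hi1,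
          integral_finsetSum _ fun l _ =>
            (integrable_finsetSum _ fun t _ => hdi _ t).const_mul _]
        simp_rw [integral_const_mul]
        simp
    _ ≤ 2 * ((n : ℝ) / 2 ^ L) + ∑ l ∈ Finset.range L, n / 2 ^ l *
          (deviationConst n a (expMoment a μ) * √((2 ^ n) ^ (l + 1)) * (√N)⁻¹) +
          Real.exp n * (deviationConst n a (expMoment a μ) * (√N)⁻¹) := by
        gcongr with l _
        exact hA (l + 1)
    _ = _ := by
        rw [mul_add, Finset.mul_sum, ← add_assoc]
        congr 1
        · congr 1
          exact Finset.sum_congr rfl fun l _ => by ring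
        · ring

end Mean

section Rate

/-- The constant in the rate of convergence of the mean transport distance. -/
noncomputable def rateConst (n : ℕ) (D : ℝ) : ℝ := 4 * n + D * (5 * n * √(2 ^ n) + Real.exp n) + 1

lemma rateConst_pos (n : ℕ) {D : ℝ} (hD : 0 ≤ D) : 0 < rateConst n D := by
  rw [rateConst]
  positivity

lemma exists_level_dyadic_le {n : ℕ} (hn : n ≠ 2) {D : ℝ} (hD : 0 ≤ D) {N : ℕ} (hN : 1 ≤ N)
    {ρ : ℝ} (hρ : 0 < ρ) (hNρ : N * ρ ^ max n 2 = 1) :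
    ∃ L : ℕ, 2 * ((n : ℝ) / 2 ^ L) + D * (√N)⁻¹ *
        (∑ l ∈ Finset.range L, n / 2 ^ l * √((2 ^ n) ^ (l + 1)) + Real.exp n) ≤
      rateConst n D * ρ := by
  have hN0 : (0 : ℝ) < N := by exact_mod_cast hN
  have hN1 : (1 : ℝ) ≤ N := by exact_mod_cast hN
  set q := √((2 : ℝ) ^ n) with hq
  have hq0 : 0 ≤ q := Real.sqrt_nonneg _
  have hqpow : ∀ l, √(((2 : ℝ) ^ n) ^ l) = q ^ l := by
    intro l
    rw [hq, Real.sqrt_eq_iff_mul_self_eq (by positivity) (by positivity), ← mul_pow,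
      Real.mul_self_sqrt (by positivity)]
  have hρ1 : ρ ≤ 1 := by
    by_contra! h
    have : 1 < ρ ^ max n 2 := one_lt_pow₀ h (by omega)
    nlinarith
  have hsN : (√(N : ℝ))⁻¹ ≤ ρ := by
    rw [inv_le_comm₀ (by positivity) hρ]
    refine Real.le_sqrt_of_sq_le ?_
    have h1 : ρ ^ max n 2 ≤ ρ ^ 2 := pow_le_pow_of_le_one hρ.le hρ1 (le_max_right _ _)
    rw [inv_pow, inv_le_comm₀ (by positivity) hN0]
    rw [← eq_inv_of_mul_eq_one_right hNρ]
    exact h1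
  have hs0 : 0 ≤ (√(N : ℝ))⁻¹ := by positivity
  have hsum : ∀ L, ∑ l ∈ Finset.range L, (n : ℝ) / 2 ^ l * √((2 ^ n) ^ (l + 1)) =
      n * q * ∑ l ∈ Finset.range L, (q / 2) ^ l := by
    intro L
    rw [Finset.mul_sum]
    refine Finset.sum_congr rfl fun l _ => ?_
    rw [hqpow, div_pow, pow_succ]
    ring
  suffices h : ∃ L : ℕ, 1 / 2 ^ L ≤ 2 * ρ ∧
      (√(N : ℝ))⁻¹ * ∑ l ∈ Finset.range L, (q / 2) ^ l ≤ 5 * ρ by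
    obtain ⟨L, h1, h2⟩ := h
    refine ⟨L, ?_⟩
    rw [hsum]
    have e1 : 2 * ((n : ℝ) / 2 ^ L) ≤ 4 * n * ρ := by
      have := mul_le_mul_of_nonneg_left h1 (Nat.cast_nonneg (α := ℝ) n)
      rw [mul_one_div] at this
      linarith
    have e2 : D * (√(N : ℝ))⁻¹ * (n * q * ∑ l ∈ Finset.range L, (q / 2) ^ l + Real.exp n) ≤
        D * (5 * n * q + Real.exp n) * ρ := by
      have h3 := mul_le_mul_of_nonneg_left h2 (show 0 ≤ (n : ℝ) * q by positivity)
      have h4 := mul_le_mul_of_nonneg_left hsN (Real.exp_pos n).le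
      have h5 := mul_le_mul_of_nonneg_left (add_le_add h3 h4) hD
      linarith
    rw [rateConst]
    linarith
  rcases Nat.lt_or_ge n 2 with hn2 | hn2
  · refine ⟨N, ?_, ?_⟩
    · rw [max_eq_right hn2.le] at hNρ
      have h1 : (N : ℝ) ≤ 2 ^ N := by exact_mod_cast Nat.lt_two_pow_self.le
      have h2 : 1 / 2 ^ N ≤ 1 / (N : ℝ) := one_div_le_one_div_of_le hN0 h1
      have h3 : 1 / (N : ℝ) = ρ ^ 2 := by
        rw [one_div]; exact (eq_inv_of_mul_eq_one_right hNρ).symm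
      nlinarith
    · have hq2 : q / 2 ≤ 3 / 4 := by
        have : q ≤ 3 / 2 := by
          rw [hq, Real.sqrt_le_left (by norm_num)]
          have : (2 : ℝ) ^ n ≤ 2 ^ 1 := pow_le_pow_right₀ (by norm_num) (by omega)
          norm_num at this ⊢
          linarith
        linarith
      have hgeom : ∑ l ∈ Finset.range N, (q / 2) ^ l ≤ 4 := by
        have h1 : ∑ l ∈ Finset.range N, (q / 2) ^ l ≤ (1 - q / 2)⁻¹ := by
          rw [← tsum_geometric_of_lt_one (by positivity) (by linarith)]
          exact (summable_geometric_of_lt_one (by positivity) (by linarith)).sum_le_tsum _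
            fun _ _ => by positivity
        refine h1.trans ?_
        rw [inv_le_comm₀ (by linarith) (by norm_num)]
        linarith
      calc _ ≤ (√(N : ℝ))⁻¹ * 4 := mul_le_mul_of_nonneg_left hgeom hs0
        _ ≤ _ := by linarith
  · have hn3 : 3 ≤ n := by omega
    rw [max_eq_left hn2] at hNρ
    obtain ⟨L, hL1, hL2⟩ := exists_nat_pow_near (one_le_one_div hρ hρ1) (one_lt_two (α := ℝ))
    have h2L : (0 : ℝ) < 2 ^ L := by positivity
    have hLρ : 1 / 2 ^ L ≤ 2 * ρ := by
      rw [div_le_iff₀ h2L]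
      rw [div_lt_iff₀ hρ, pow_succ] at hL2
      linarith
    refine ⟨L, hLρ, ?_⟩
    have hq2 : 7 / 5 ≤ q / 2 := by
      have : 14 / 5 ≤ q := by
        refine Real.le_sqrt_of_sq_le ?_
        have : (2 : ℝ) ^ 3 ≤ 2 ^ n := pow_le_pow_right₀ (by norm_num) hn3
        norm_num at this ⊢
        linarith
      linarith
    have hgeom : ∑ l ∈ Finset.range L, (q / 2) ^ l ≤ 5 / 2 * (q / 2) ^ L := by
      rw [geom_sum_eq (by linarith), div_le_iff₀ (by linarith)]
      have : 0 ≤ (q / 2) ^ L := by positivity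
      nlinarith
    have hqL : (√(N : ℝ))⁻¹ * q ^ L ≤ 1 := by
      rw [← hqpow, ← Real.sqrt_inv, ← Real.sqrt_mul (by positivity)]
      refine Real.sqrt_le_one.2 ?_
      rw [← pow_mul, mul_comm n L, pow_mul, inv_eq_of_mul_eq_one_right hNρ,
        ← mul_pow]
      refine pow_le_one₀ (by positivity) ?_
      rwa [le_div_iff₀ hρ, mul_comm] at hL1
    calc (√(N : ℝ))⁻¹ * ∑ l ∈ Finset.range L, (q / 2) ^ l
        ≤ (√(N : ℝ))⁻¹ * (5 / 2 * (q / 2) ^ L) := mul_le_mul_of_nonneg_left hgeom hs0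
      _ = 5 / 2 * ((√(N : ℝ))⁻¹ * q ^ L) * (1 / 2 ^ L) := by
          rw [div_pow]; ring
      _ ≤ 5 / 2 * 1 * (2 * ρ) := by gcongr
      _ = 5 * ρ := by ring

end Rate

section Concentration

variable {n N : ℕ} {a : ℝ} {μ : Measure (Fin n → ℝ)} [IsProbabilityMeasure μ]

lemma deviationConst_nonneg (n : ℕ) (a A : ℝ) : 0 ≤ deviationConst n a A := Real.sqrt_nonneg _

theorem integral_min_allocationCost_le (hn : n ≠ 2) (ha : 1 < a)
    (hi : Integrable (fun x => Real.exp (l1norm x ^ a)) μ) {M : ℕ}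
    (hM : ∀ᵐ ξ ∂μ, ∀ i, -(M : ℝ) ≤ ξ i ∧ ξ i < (M : ℝ)) (hN : 1 ≤ N) {δ : ℝ} (hδ : 0 ≤ δ)
    {ρ : ℝ} (hρ : 0 < ρ) (hNρ : N * ρ ^ max n 2 = 1) :
    ∫ x : Fin N → (Fin n → ℝ), min (allocationCost μ x) δ ∂(Measure.pi fun _ => μ) ≤
      rateConst n (deviationConst n a (expMoment a μ)) * ρ := by
  obtain ⟨L, hL⟩ := exists_level_dyadic_le hn (deviationConst_nonneg n a (expMoment a μ)) hN hρ hNρ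
  exact (integral_min_allocationCost_le_dyadic ha hi hM hN hδ L).trans hL

/-- Chernoff's bound for the transport distance, when its mean is at most `ε / 2`. -/
lemma measureReal_le_W1_le_exp (ha : 1 < a)
    (hi : Integrable (fun x => Real.exp (l1norm x ^ a)) μ) (hN : 1 ≤ N) {ε : ℝ} (hε : 0 < ε)
    (hmean : ∫ x : Fin N → (Fin n → ℝ), min (allocationCost μ x) ε ∂(Measure.pi fun _ => μ) ≤ ε / 2)
    {t ψ : ℝ} (ht : 0 ≤ t)
    (h1 : ∀ h : (Fin n → ℝ) → ℝ, Measurable h → (∃ B, ∀ y, |h y| ≤ B) →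
      (∀ y z, |h y - h z| ≤ l1norm (y - z)) →
      ∫ y, Real.exp (t * (h y - ∫ z, h z ∂μ)) ∂μ ≤ Real.exp ψ) :
    (Measure.pi fun _ : Fin N => μ).real {x | ENNReal.ofReal ε ≤ W1 μ (empirical x)} ≤
      Real.exp (-N * (t * (ε / 2) - ψ)) := by
  have hl := integrable_l1norm_of_expMoment ha hi
  refine le_trans (measureReal_mono ?_) (measureReal_le_exp_of_lipschitz μ
    (fun y z => l1norm (y - z)) (fun y => by rw [sub_self, l1norm_zero]) ht h1 hN
    (fun x => min (allocationCost μ x) ε)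
    ((continuous_allocationCost hN hl).measurable.min measurable_const) ⟨ε, fun x => ?_⟩
    (fun x y => ?_) (ε / 2))
  · intro x hx
    have := le_allocationCost_of_le_W1 hN hl x hx
    change ε / 2 ≤ min (allocationCost μ x) ε - _
    rw [min_eq_right this]
    linarith
  · rw [abs_of_nonneg (le_min (allocationCost_nonneg x) hε.le)]
    exact min_le_right _ _
  · exact (abs_min_sub_min_le_max _ _ _ _).trans (by
      rw [sub_self, abs_zero, max_eq_left (abs_nonneg _)]
      exact abs_allocationCost_sub_le hN hl x y)

lemma measureReal_le_W1_le_of_le_one (ha : 1 < a)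
    (hi : Integrable (fun x => Real.exp (l1norm x ^ a)) μ) (hN : 1 ≤ N) {ε : ℝ} (hε : 0 < ε)
    (hε1 : ε ≤ 1)
    (hmean : ∫ x : Fin N → (Fin n → ℝ), min (allocationCost μ x) ε ∂(Measure.pi fun _ => μ) ≤
      ε / 2) :
    (Measure.pi fun _ : Fin N => μ).real {x | ENNReal.ofReal ε ≤ W1 μ (empirical x)} ≤
      Real.exp (-(1 / (16 * laplaceConst a (expMoment a μ)) * (N * ε ^ 2))) := by
  have hC := one_le_laplaceConst (a := a) (one_le_expMoment hi)
  set C := laplaceConst a (expMoment a μ) with hCdef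
  have ht : 0 ≤ ε / (4 * C) := by positivity
  have ht1 : ε / (4 * C) ≤ 1 := div_le_one_of_le₀ (by linarith) (by linarith)
  refine (measureReal_le_W1_le_exp ha hi hN hε hmean ht
    fun h hm hB hL => integral_exp_le_of_le_one ha hi hm hB hL ht ht1).trans_eq ?_
  rw [← hCdef]
  congr 1
  field_simp
  ring

lemma measureReal_le_W1_le_of_large (ha : 1 < a)
    (hi : Integrable (fun x => Real.exp (l1norm x ^ a)) μ) (hN : 1 ≤ N) {ε : ℝ}
    (hε : 4 * laplaceConst a (expMoment a μ) ≤ ε)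
    (hmean : ∫ x : Fin N → (Fin n → ℝ), min (allocationCost μ x) ε ∂(Measure.pi fun _ => μ) ≤
      ε / 2) :
    (Measure.pi fun _ : Fin N => μ).real {x | ENNReal.ofReal ε ≤ W1 μ (empirical x)} ≤
      Real.exp (-(laplaceConst a (expMoment a μ) / (4 * laplaceConst a (expMoment a μ)) ^ a *
        (N * ε ^ a))) := by
  have hC := one_le_laplaceConst (a := a) (one_le_expMoment hi)
  set C := laplaceConst a (expMoment a μ) with hCdef
  have ha' : 0 < a - 1 := by linarith
  have hε0 : 0 < ε := by linarith
  have hu1 : 1 ≤ ε / (4 * C) := by rwa [one_le_div (by linarith)]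
  set u := ε / (4 * C) with hu
  have hu0 : 0 < u := by linarith
  have ht1 : 1 ≤ u ^ (a - 1) := Real.one_le_rpow hu1 ha'.le
  refine (measureReal_le_W1_le_exp ha hi hN hε0 hmean (by linarith)
    fun h hm hB hL => integral_exp_le_of_one_le ha hi hm hB hL ht1).trans_eq ?_
  rw [← hCdef]
  have h1 : (u ^ (a - 1)) ^ (1 + (a - 1)⁻¹) = u ^ a := by
    rw [← Real.rpow_mul hu0.le]
    congr 1
    field_simp
    ring
  have h2 : u ^ (a - 1) * ε = 4 * C * u ^ a := by
    have h3 : u ^ (a - 1) * u = u ^ a := by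
      rw [← Real.rpow_add_one hu0.ne']; congr 1; ring
    have h4 : ε = 4 * C * u := by rw [hu]; field_simp
    rw [← h3]
    calc u ^ (a - 1) * ε = u ^ (a - 1) * (4 * C * u) := by rw [← h4]
      _ = _ := by ring
  have h5 : u ^ a = ε ^ a / (4 * C) ^ a := Real.div_rpow hε0.le (by linarith) a
  rw [h1]
  congr 1
  have h6 : u ^ (a - 1) * (ε / 2) = 2 * C * u ^ a := by linarith
  rw [h6, h5]
  ring

/-- The constants of the concentration bound in terms of the constants `C` and `K` of the Laplace
transform and of the rate of convergence of the mean. -/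
theorem exists_concentration_constants (n : ℕ) {a : ℝ} (ha : 1 < a) {C K : ℝ} (hC : 1 ≤ C)
    (hK : 0 < K) :
    ∃ c₁ c₂ : ℝ, 1 < c₁ ∧ 0 < c₂ ∧ ∀ (N : ℕ), 1 ≤ N → ∀ (ρ : ℝ), 0 < ρ → N * ρ ^ max n 2 = 1 →
      ∀ P : ℝ → ℝ, (∀ ε, P ε ≤ 1) → (∀ ε ε', ε ≤ ε' → P ε' ≤ P ε) →
      (∀ ε, 0 < ε → ε ≤ 1 → K * ρ ≤ ε / 2 → P ε ≤ Real.exp (-(1 / (16 * C) * (N * ε ^ 2)))) →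
      (∀ ε, 4 * C ≤ ε → K * ρ ≤ ε / 2 → P ε ≤ Real.exp (-(C / (4 * C) ^ a * (N * ε ^ a)))) →
      ∀ ε, 0 < ε → P ε ≤ concentrationBound n N a c₁ c₂ ε := by
  have hmax : 2 ≤ max n 2 := le_max_right _ _
  set d := max n 2 with hd
  set R := max (4 * C) (2 * K) with hR
  have hR4 : 4 * C ≤ R := le_max_left _ _
  have hRK : 2 * K ≤ R := le_max_right _ _
  have hR1 : 1 ≤ R := by linarith
  have hRa : 1 ≤ R ^ a := Real.one_le_rpow hR1 (by linarith)
  set B := (2 * K) ^ d with hB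
  have hB0 : 0 < B := by positivity
  set c := 1 / (16 * C * R ^ a) with hc
  have hc0 : 0 < c := by positivity
  have hcR : c * R ^ a = 1 / (16 * C) := by
    rw [hc]; field_simp
  have hc1 : c ≤ 1 / (16 * C) := by
    rw [← hcR]; exact le_mul_of_one_le_right hc0.le hRa
  refine ⟨Real.exp (c * (B * R ^ a)), c, Real.one_lt_exp_iff.2 (by positivity), hc0, ?_⟩
  intro N hN ρ hρ hNρ P hP1 hPm hPs hPl ε hε
  have hN0 : (0 : ℝ) < N := by exact_mod_cast hN
  have hρ1 : ρ ≤ 1 := by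
    by_contra! h
    have : 1 < ρ ^ d := one_lt_pow₀ h (by omega)
    have : (1 : ℝ) ≤ N := by exact_mod_cast hN
    nlinarith
  have hc₁ : 1 ≤ Real.exp (c * (B * R ^ a)) := Real.one_le_exp (by positivity)
  have hNB : ∀ δ, 0 ≤ δ → δ / 2 ≤ K * ρ → N * δ ^ d ≤ B := by
    intro δ hδ h
    calc N * δ ^ d ≤ N * (2 * K * ρ) ^ d := by
          gcongr
          linarith
      _ = (N * ρ ^ d) * B := by rw [mul_pow]; ring
      _ = B := by rw [hNρ, one_mul]
  have hgood : ∀ x, P ε ≤ Real.exp (-x) → ∀ y, c * y ≤ x →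
      P ε ≤ Real.exp (c * (B * R ^ a)) * Real.exp (-c * y) := by
    intro x hx y hy
    refine hx.trans ((Real.exp_le_exp.2 (by linarith)).trans
      (le_mul_of_one_le_left (Real.exp_pos _).le hc₁))
  have hbad : ∀ y, y ≤ B * R ^ a → P ε ≤ Real.exp (c * (B * R ^ a)) * Real.exp (-c * y) := by
    intro y hy
    refine (hP1 ε).trans ?_
    rw [← Real.exp_add]
    refine Real.one_le_exp ?_
    have := mul_le_mul_of_nonneg_left hy hc0.le
    linarith
  rw [concentrationBound]
  split_ifs with h1
  · rw [mul_assoc]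
    rcases le_total (K * ρ) (ε / 2) with h | h
    · refine hgood _ (hPs ε hε h1 h) _ ?_
      refine mul_le_mul hc1 ?_ (by positivity) (by positivity)
      exact mul_le_mul_of_nonneg_left (pow_le_pow_of_le_one hε.le h1 hmax) hN0.le
    · refine hbad _ ((hNB ε hε.le h).trans (le_mul_of_one_le_right hB0.le hRa))
  · push Not at h1
    rw [mul_assoc]
    rcases le_total R ε with hRε | hRε
    · refine hgood _ (hPl ε (by linarith) ?_) _ ?_
      · have := mul_le_mul_of_nonneg_left hρ1 hK.le
        linarith
      · refine mul_le_mul_of_nonneg_right ?_ (by positivity)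
        have h4 : (4 * C) ^ a ≤ R ^ a := Real.rpow_le_rpow (by linarith) hR4 (by linarith)
        rw [hc]
        rw [div_le_div_iff₀ (by positivity) (by positivity), one_mul]
        refine h4.trans ?_
        have : 1 ≤ C * (16 * C) := by nlinarith
        calc R ^ a = 1 * R ^ a := (one_mul _).symm
          _ ≤ C * (16 * C) * R ^ a := by gcongr
          _ = _ := by ring
    · have hεa : ε ^ a ≤ R ^ a := Real.rpow_le_rpow hε.le hRε (by linarith)
      rcases le_total (K * ρ) (1 / 2) with h | h
      · refine hgood _ ((hPm 1 ε h1.le).trans (hPs 1 one_pos le_rfl h)) _ ?_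
        rw [← hcR, one_pow, mul_one, mul_assoc]
        refine mul_le_mul_of_nonneg_left ?_ hc0.le
        rw [mul_comm]
        exact mul_le_mul_of_nonneg_right hεa hN0.le
      · refine hbad _ ?_
        have := hNB 1 zero_le_one h
        rw [one_pow, mul_one] at this
        exact mul_le_mul this hεa (by positivity) hB0.le

end Concentration

section Radius

lemma concentrationBound_lt_of_lt {n N : ℕ} {a c₁ c₂ : ℝ} (ha : 0 < a) (hc₁ : 0 < c₁) (hc₂ : 0 < c₂)
    (hN : 1 ≤ N) {ε ε' : ℝ} (hε : 0 < ε) (h : ε < ε') :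
    concentrationBound n N a c₁ c₂ ε' < concentrationBound n N a c₁ c₂ ε := by
  have hN0 : (0 : ℝ) < N := by exact_mod_cast hN
  have hd : max n 2 ≠ 0 := by omega
  have key : ∀ u v : ℝ, u < v → c₁ * Real.exp (-c₂ * N * v) < c₁ * Real.exp (-c₂ * N * u) := by
    intro u v huv
    refine mul_lt_mul_of_pos_left (Real.exp_lt_exp.2 ?_) hc₁
    have := mul_lt_mul_of_pos_left huv (mul_pos hc₂ hN0)
    linarith
  rw [concentrationBound, concentrationBound]
  split_ifs with h1 h2 h2
  · exact key _ _ (pow_lt_pow_left₀ h hε.le hd)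
  · linarith
  · exact key _ _ ((pow_le_one₀ hε.le h2).trans_lt (Real.one_lt_rpow (by linarith) ha))
  · exact key _ _ (Real.rpow_lt_rpow hε.le h ha)

lemma radius_pos {n N : ℕ} {a c₁ c₂ β : ℝ} (hc₁ : 1 < c₁) (hc₂ : 0 < c₂) (hN : 1 ≤ N)
    (hβ : 0 < β) (hβ1 : β < 1) : 0 < radius n N a c₁ c₂ β := by
  have hN0 : (0 : ℝ) < N := by exact_mod_cast hN
  have hlog : 0 < Real.log (c₁ * β⁻¹) := Real.log_pos (by
    rw [← div_eq_mul_inv, one_lt_div hβ]; linarith)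
  rw [radius]
  split_ifs <;> positivity

lemma concentrationBound_radius {n N : ℕ} {a c₁ c₂ β : ℝ} (ha : 0 < a) (hc₁ : 1 < c₁)
    (hc₂ : 0 < c₂) (hN : 1 ≤ N) (hβ : 0 < β) (hβ1 : β < 1) :
    concentrationBound n N a c₁ c₂ (radius n N a c₁ c₂ β) = β := by
  have hN0 : (0 : ℝ) < N := by exact_mod_cast hN
  have hlog : 0 < Real.log (c₁ * β⁻¹) := Real.log_pos (by
    rw [← div_eq_mul_inv, one_lt_div hβ]; linarith)
  have hval : c₁ * Real.exp (-c₂ * N * (Real.log (c₁ * β⁻¹) / (c₂ * N))) = β := by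
    have : -c₂ * N * (Real.log (c₁ * β⁻¹) / (c₂ * N)) = -Real.log (c₁ * β⁻¹) := by field_simp
    rw [this, Real.exp_neg, Real.exp_log (by positivity)]
    field_simp
  have hd : max n 2 ≠ 0 := by omega
  have hu0 : 0 < Real.log (c₁ * β⁻¹) / (c₂ * N) := by positivity
  rw [radius]
  split_ifs with h
  · have hu1 : Real.log (c₁ * β⁻¹) / (c₂ * N) ≤ 1 := by
      rw [← div_div]; exact div_le_one_of_le₀ h hN0.le
    rw [concentrationBound, if_pos (Real.rpow_le_one hu0.le hu1 (by positivity)), one_div,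
      Real.rpow_inv_natCast_pow hu0.le hd, hval]
  · have hu1 : 1 < Real.log (c₁ * β⁻¹) / (c₂ * N) := by
      rw [← div_div, one_lt_div hN0]; exact not_le.1 h
    rw [concentrationBound, if_neg (not_le.2 (Real.one_lt_rpow hu1 (by positivity))), one_div,
      Real.rpow_inv_rpow hu0.le ha.ne', hval]

lemma isLeast_radius {n N : ℕ} {a c₁ c₂ β : ℝ} (ha : 0 < a) (hc₁ : 1 < c₁)
    (hc₂ : 0 < c₂) (hN : 1 ≤ N) (hβ : 0 < β) (hβ1 : β < 1) :
    IsLeast {ε : ℝ | 0 < ε ∧ 1 - β ≤ 1 - concentrationBound n N a c₁ c₂ ε}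
      (radius n N a c₁ c₂ β) := by
  have hb := concentrationBound_radius (n := n) ha hc₁ hc₂ hN hβ hβ1
  refine ⟨⟨radius_pos hc₁ hc₂ hN hβ hβ1, by rw [hb]⟩, ?_⟩
  rintro ε ⟨hε, h⟩
  by_contra! hlt
  have := concentrationBound_lt_of_lt (n := n) ha (zero_lt_one.trans hc₁) hc₂ hN hε hlt
  linarith

end Radius

section Support

variable {n : ℕ}

lemma noisyDistribution_compl_eq_zero {O : Kernel (Fin n → ℝ) (Fin n → ℝ)}
    {F : Measure (Fin n → ℝ)} {X S : Set (Fin n → ℝ)} (hF : F Xᶜ = 0) (hS : MeasurableSet S)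
    (hO : ∀ x ∈ X, O x Sᶜ = 0) : noisyDistribution O F Sᶜ = 0 := by
  rw [noisyDistribution, Measure.bind_apply hS.compl O.measurable.aemeasurable,
    lintegral_eq_zero_iff (O.measurable_coe hS.compl)]
  have : ∀ᵐ x ∂F, x ∈ X := hF
  filter_upwards [this] with x hx using hO x hx

lemma exists_nat_bound_of_isCompact {S : Set (Fin n → ℝ)} (hS : IsCompact S) :
    ∃ M : ℕ, ∀ x ∈ S, ∀ i, -(M : ℝ) ≤ x i ∧ x i < (M : ℝ) := by
  obtain ⟨R, hR⟩ := hS.isBounded.exists_norm_le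
  obtain ⟨M, hM⟩ := exists_nat_gt R
  refine ⟨M, fun x hx i => ?_⟩
  have h1 : |x i| ≤ R := (norm_le_pi_norm x i).trans (hR x hx)
  have := abs_le.1 h1
  constructor <;> linarith

lemma integrable_exp_of_ae_mem_isCompact {μ : Measure (Fin n → ℝ)} [IsFiniteMeasure μ]
    {S : Set (Fin n → ℝ)} (hS : IsCompact S) (hμ : ∀ᵐ x ∂μ, x ∈ S) {a : ℝ} (ha : 0 ≤ a) :
    Integrable (fun x => Real.exp (l1norm x ^ a)) μ := by
  have hc : Continuous fun x : Fin n → ℝ => Real.exp (l1norm x ^ a) :=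
    Real.continuous_exp.comp (continuous_l1norm.rpow_const fun _ => Or.inr ha)
  obtain ⟨B, hB⟩ := hS.exists_bound_of_continuousOn hc.continuousOn
  exact Integrable.of_bound hc.aestronglyMeasurable B (hμ.mono fun x hx => hB x hx)

end Support

end NoisyDRO

theorem mainTheorem10 (n : ℕ) (hn : n ≠ 2) (a : ℝ) (ha : 1 < a) (A : ℝ) :
    ∃ c₁ c₂ : ℝ, 0 < c₁ ∧ 0 < c₂ ∧
      ∀ (xmin xmax : Fin n → ℝ) (S : Set (Fin n → ℝ))
        (F : Measure (Fin n → ℝ)) [IsProbabilityMeasure F]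
        (O : Kernel (Fin n → ℝ) (Fin n → ℝ)) [IsMarkovKernel O],
        F (Set.Icc xmin xmax)ᶜ = 0 →
        IsCompact S → Convex ℝ S → Set.Icc xmin xmax ⊆ S →
        (∀ x ∈ Set.Icc xmin xmax, O x Sᶜ = 0) →
        NoisyDRO.expMoment a (NoisyDRO.noisyDistribution O F) = A →
        ∀ N : ℕ, 1 ≤ N →
          (∀ ε : ℝ, 0 < ε →
            (NoisyDRO.sampleLaw N (NoisyDRO.noisyDistribution O F)).real
                {x | ENNReal.ofReal ε ≤
                  NoisyDRO.W1 (NoisyDRO.noisyDistribution O F) (NoisyDRO.empirical x)}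
              ≤ NoisyDRO.concentrationBound n N a c₁ c₂ ε) ∧
          (∀ β : ℝ, 0 < β → β < 1 →
            NoisyDRO.concentrationBound n N a c₁ c₂ (NoisyDRO.radius n N a c₁ c₂ β) = β ∧
            IsLeast {ε : ℝ | 0 < ε ∧ 1 - β ≤ 1 - NoisyDRO.concentrationBound n N a c₁ c₂ ε}
              (NoisyDRO.radius n N a c₁ c₂ β) ∧
            1 - β ≤ (NoisyDRO.sampleLaw N (NoisyDRO.noisyDistribution O F)).real
              {x | NoisyDRO.noisyDistribution O F ∈
                NoisyDRO.wassersteinBall S (NoisyDRO.radius n N a c₁ c₂ β)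
                  (NoisyDRO.empirical x)}) := by
  have hdev := NoisyDRO.deviationConst_nonneg n a (max A 1)
  obtain ⟨c₁, c₂, hc₁, hc₂, hconc⟩ := NoisyDRO.exists_concentration_constants n ha
    (NoisyDRO.one_le_laplaceConst (a := a) (le_max_right A 1)) (NoisyDRO.rateConst_pos n hdev)
  refine ⟨c₁, c₂, by linarith, hc₂, ?_⟩
  intro xmin xmax S F _ O _ hF hS _ _ hO hA N hN
  have hN0 : (0 : ℝ) < N := by exact_mod_cast hN
  set μ := NoisyDRO.noisyDistribution O F with hμ
  have hμS : μ Sᶜ = 0 := NoisyDRO.noisyDistribution_compl_eq_zero hF hS.measurableSet hO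
  have hμae : ∀ᵐ x ∂μ, x ∈ S := hμS
  obtain ⟨M, hM⟩ := NoisyDRO.exists_nat_bound_of_isCompact hS
  have hi := NoisyDRO.integrable_exp_of_ae_mem_isCompact hS hμae (show 0 ≤ a by linarith)
  have hA1 : max A 1 = A := max_eq_left (hA ▸ NoisyDRO.one_le_expMoment hi)
  rw [hA1, ← hA] at hconc
  have hd : max n 2 ≠ 0 := by omega
  have hρpow : N * (((N : ℝ)⁻¹) ^ (((max n 2 : ℕ) : ℝ)⁻¹)) ^ max n 2 = 1 := by
    rw [Real.rpow_inv_natCast_pow (by positivity) hd, mul_inv_cancel₀ hN0.ne']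
  have hρ : 0 < ((N : ℝ)⁻¹) ^ (((max n 2 : ℕ) : ℝ)⁻¹) := by positivity
  have hmean := fun (δ : ℝ) (hδ : 0 ≤ δ) => NoisyDRO.integral_min_allocationCost_le hn ha hi
    (hμae.mono fun x hx => hM x hx) hN hδ hρ hρpow
  have hbound : ∀ ε : ℝ, 0 < ε →
      (NoisyDRO.sampleLaw N μ).real {x | ENNReal.ofReal ε ≤ NoisyDRO.W1 μ (NoisyDRO.empirical x)}
        ≤ NoisyDRO.concentrationBound n N a c₁ c₂ ε := by
    refine hconc N hN _ hρ hρpow (fun ε => (NoisyDRO.sampleLaw N μ).real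
      {x | ENNReal.ofReal ε ≤ NoisyDRO.W1 μ (NoisyDRO.empirical x)}) ?_ ?_ ?_ ?_
    · exact fun ε => measureReal_le_one (μ := Measure.pi fun _ : Fin N => μ)
    · exact fun ε ε' h => measureReal_mono (μ := Measure.pi fun _ : Fin N => μ)
        fun x hx => (ENNReal.ofReal_le_ofReal h).trans hx
    · exact fun ε hε hε1 h =>
        NoisyDRO.measureReal_le_W1_le_of_le_one ha hi hN hε hε1 ((hmean ε hε.le).trans h)
    · intro ε hε h
      have hC := NoisyDRO.one_le_laplaceConst (a := a) (NoisyDRO.one_le_expMoment hi)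
      exact NoisyDRO.measureReal_le_W1_le_of_large ha hi hN hε
        ((hmean ε (by linarith)).trans h)
  refine ⟨hbound, fun β hβ hβ1 => ?_⟩
  have ha0 : 0 < a := by linarith
  have hb := NoisyDRO.concentrationBound_radius (n := n) ha0 hc₁ hc₂ hN hβ hβ1
  refine ⟨hb, NoisyDRO.isLeast_radius ha0 hc₁ hc₂ hN hβ hβ1, ?_⟩
  have hr := hbound _ (NoisyDRO.radius_pos (n := n) (a := a) hc₁ hc₂ hN hβ hβ1)
  rw [hb] at hr
  set r := NoisyDRO.radius n N a c₁ c₂ β with hrdef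
  set s := {x : Fin N → (Fin n → ℝ) | μ ∈ NoisyDRO.wassersteinBall S r (NoisyDRO.empirical x)}
    with hs
  set s' := {x : Fin N → (Fin n → ℝ) |
    ENNReal.ofReal r ≤ NoisyDRO.W1 μ (NoisyDRO.empirical x)} with hs'
  have hcover : s ∪ s' = Set.univ := by
    refine Set.eq_univ_of_forall fun x => ?_
    rcases le_total (NoisyDRO.W1 μ (NoisyDRO.empirical x)) (ENNReal.ofReal r) with h | h
    · exact Or.inl ⟨inferInstance, hμS, h⟩
    · exact Or.inr h
  have hunion : 1 ≤ (NoisyDRO.sampleLaw N μ).real s + (NoisyDRO.sampleLaw N μ).real s' := by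
    have h1 : (Measure.pi fun _ : Fin N => μ).real (s ∪ s') = 1 := by
      rw [hcover, probReal_univ]
    exact h1.symm.le.trans (measureReal_union_le s s')
  linarith
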